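/- Let $d,n\ge 2$ be integers. For a finite number $m$ of modes, the space $(\mathbb F^n)^{\otimes m}$ ($\mathbb F=\mathbb R$ or $\mathbb C$) carries the Euclidean inner product and norm $\|\cdot\|$. For real tensors put $\|X\|_{\infty,\mathbb R}=\max|\langle Y,X\rangle|$ over all $Y=y_1\otimes\cdots\otimes y_m$ with $y_k\in\mathbb R^n$, $\|y_k\|=1$, and $\|X\|_{1,\mathbb R}=\inf\sum_{k}\|X_k\|$ over all finite decompositions $X=\sum_k X_k$ into real rank-one tensors. Let $\mathrm S^{2d}\mathbb R^n\subset(\mathbb R^n)^{\otimes 2d}$ be the space of symmetric tensors, and let $\beta=\max\{\|X\|_{1,\mathbb R}: X\in \mathrm S^{2d}\mathbb R^n,\ \|X\|=1\}$. A tensor $B=[b_{\mathbf i,\mathbf j}]$ of order $2d$ is viewed as a matrix with rows $\mathbf i\in[n]^d$ and columns $\mathbf j\in[n]^d$, and $\operatorname{tr}B=\sum_{\mathbf i}b_{\mathbf i,\mathbf i}$. Let $\mathrm S^{2d}\mathbb R^n_{+,1}$ be the set of symmetric density tensors, that is, of $R\in \mathrm S^{2d}\mathbb R^n$ that are positive semidefinite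 with $\operatorname{tr}R=1$. Such an $R$ is *separable* if it is a convex combination of tensors $X\otimes\overline X$ with $X=x_1\otimes\cdots\otimes x_d$, $x_k\in\mathbb C^n$, $\|x_k\|=1$, and *real strongly separable* if it is a convex combination of tensors $x^{\otimes 2d}$ with $x\in\mathbb R^n$, $\|x\|=1$. Let $R^\star=\int_{\|x\|=1}x^{\otimes 2d}\,d\lambda_n(x)$, where $\lambda_n$ is the normalized Lebesgue measure on the unit sphere of $\mathbb R^n$, and $$c_{n,d}=\frac{\prod_{k=0}^{d-1}\left(\frac12+k\right)}{\prod_{k=0}^{d-1}\left(\frac n2+k\right)}.$$ (1) Every $R\in \mathrm S^{2d}\mathbb R^n_{+,1}$ satisfies $$c_{n,d}\le\|R\|_{\infty,\mathbb R}\le 1,\qquad 1\le\|R\|_{1,\mathbb R}\le\beta .$$ Moreover $\|R\|_{\infty,\mathbb R}=1$ if and only if $R=x^{\otimes 2d}$ for some $x\in\mathbb R^n$ with $\|x\|=1$; $\|R\|_{\infty,\mathbb R}=c_{n,d}$ if and only if $R=R^\star$; and $\|R\|_{1,\mathbb R}=1$ if and only if $R$ is separable, if and only if $R$ is real strongly separable.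 The tensor $R^\star$ itself lies in $\mathrm S^{2d}\mathbb R^n_{+,1}$. (2) The set of real strongly separable tensors in $\mathrm S^{2d}\mathbb R^n_{+,1}$ is a proper face of the unit ball of $\|\cdot\|_{1,\mathbb R}$ in $\mathrm S^{2d}\mathbb R^n$. Its dimension is $\binom{n+2d-1}{2d}-1$, the largest dimension of a proper face of this ball. If $B\in \mathrm S^{2d}\mathbb R^n$ and $\|B\|_{1,\mathbb R}\le 1$, then $\operatorname{tr}B\le 1$, with equality if and only if $B$ is real strongly separable. Every real strongly separable tensor is a convex combination of at most $\binom{n+2d-1}{2d}$ tensors $x^{\otimes 2d}$ with $x\in\mathbb R^n$, $\|x\|=1$. -/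

import Mathlib

open MeasureTheory
open scoped ComplexConjugate ComplexOrder

noncomputable section

namespace SymDensity

/-- Tensors over `𝕜` with modes indexed by `ι`, all of dimension `n`, with the Euclidean
(Hilbert-Schmidt) inner product and norm. -/
abbrev Tensor (𝕜 : Type) [RCLike 𝕜] (ι : Type) (n : ℕ) : Type :=
  EuclideanSpace 𝕜 (ι → Fin n)

section General

variable {𝕜 : Type} [RCLike 𝕜] {ι : Type} [Fintype ι] {n : ℕ}

/-- The tensor product `⊗ₖ xₖ`, with entries `∏ₖ (xₖ)_{i k}`. -/
def outer (x : ι → EuclideanSpace 𝕜 (Fin n)) : Tensor 𝕜 ι n :=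
  WithLp.toLp 2 fun i => ∏ k, x k (i k)

variable (𝕜 ι n)

/-- The product states: tensor products of unit vectors. -/
def productStates : Set (Tensor 𝕜 ι n) :=
  {X | ∃ x : ι → EuclideanSpace 𝕜 (Fin n), (∀ k, ‖x k‖ = 1) ∧ X = outer x}

/-- The rank-one tensors: nonzero tensor products of vectors. -/
def rankOne : Set (Tensor 𝕜 ι n) :=
  {X | X ≠ 0 ∧ ∃ x : ι → EuclideanSpace 𝕜 (Fin n), X = outer x}

/-- The subspace of symmetric tensors. -/
def symTensors : Submodule 𝕜 (Tensor 𝕜 ι n) where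
  carrier := {X | ∀ (ω : Equiv.Perm ι) (i : ι → Fin n), X (i ∘ ω) = X i}
  add_mem' := by
    intro X Y hX hY ω i
    simp [hX ω i, hY ω i]
  zero_mem' := by
    intro ω i
    simp
  smul_mem' := by
    intro c X hX ω i
    simp [hX ω i]

variable {𝕜 ι n} [DecidableEq ι]

/-- The spectral norm `‖X‖_{∞,𝕜}`: the maximum of `|⟨Y, X⟩|` over product states `Y`. -/
def specNorm (X : Tensor 𝕜 ι n) : ℝ :=
  sSup {t | ∃ Y ∈ productStates 𝕜 ι n, t = ‖inner 𝕜 Y X‖}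

/-- The nuclear norm `‖X‖_{1,𝕜}`: the infimum of `∑ ‖Zₖ‖` over all finite decompositions
`X = ∑ Zₖ` into rank-one tensors. -/
def nucNorm (X : Tensor 𝕜 ι n) : ℝ :=
  sInf {t | ∃ (r : ℕ) (Z : Fin r → Tensor 𝕜 ι n),
    (∀ k, Z k ∈ rankOne 𝕜 ι n) ∧ X = ∑ k, Z k ∧ t = ∑ k, ‖Z k‖}

variable (𝕜 ι n)

/-- The maximum of the nuclear norm over symmetric tensors of Euclidean norm one. -/
def betaSym : ℝ :=
  sSup {t | ∃ X ∈ symTensors 𝕜 ι n, ‖X‖ = 1 ∧ t = nucNorm X}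

end General

/-- The modes of a tensor of order `2d`: `d` row modes followed by `d` column modes. -/
abbrev Modes (d : ℕ) : Type := Fin d ⊕ Fin d

/-- The power `x^{⊗ 2d}` of a real vector. -/
def power (d : ℕ) {n : ℕ} (x : EuclideanSpace ℝ (Fin n)) : Tensor ℝ (Modes d) n :=
  outer fun _ => x

/-- A tensor of order `2d` viewed as a matrix with rows and columns indexed by `[n]^d`. -/
def unfold {𝕜 : Type} [RCLike 𝕜] {d n : ℕ} (B : Tensor 𝕜 (Modes d) n) :
    Matrix (Fin d → Fin n) (Fin d → Fin n) 𝕜 :=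
  fun i j => B (Sum.elim i j)

/-- The trace of a tensor of order `2d`, viewed as a matrix. -/
def tensorTrace {𝕜 : Type} [RCLike 𝕜] {d n : ℕ} (B : Tensor 𝕜 (Modes d) n) : 𝕜 :=
  (unfold B).trace

/-- The density tensors: (complex) positive semidefinite Hermitian tensors of trace one. -/
def densityTensors (d n : ℕ) : Set (Tensor ℂ (Modes d) n) :=
  {B | (unfold B).PosSemidef ∧ tensorTrace B = 1}

/-- The tensor `X ⊗ X̄`. -/
def pureDensity {d n : ℕ} (X : Tensor ℂ (Fin d) n) : Tensor ℂ (Modes d) n :=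
  WithLp.toLp 2 fun i => X (i ∘ Sum.inl) * conj (X (i ∘ Sum.inr))

/-- The separable density tensors: convex combinations of `X ⊗ X̄` for complex product
states `X`. -/
def separable (d n : ℕ) : Set (Tensor ℂ (Modes d) n) :=
  convexHull ℝ {ρ | ∃ X ∈ productStates ℂ (Fin d) n, ρ = pureDensity X}

/-- A real tensor viewed as a complex tensor. -/
def complexify {ι : Type} {n : ℕ} (R : Tensor ℝ ι n) : Tensor ℂ ι n :=
  WithLp.toLp 2 fun i => (R i : ℂ)

/-- The symmetric density tensors: real symmetric tensors of order `2d` that are density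
tensors. -/
def symDensityTensors (d n : ℕ) : Set (Tensor ℝ (Modes d) n) :=
  {R | R ∈ symTensors ℝ (Modes d) n ∧ complexify R ∈ densityTensors d n}

/-- The real strongly separable tensors: the symmetric density tensors that are convex
combinations of `x^{⊗ 2d}` for real unit vectors `x`. -/
def stronglySeparable (d n : ℕ) : Set (Tensor ℝ (Modes d) n) :=
  {R | R ∈ symDensityTensors d n ∧
    R ∈ convexHull ℝ {T | ∃ x : EuclideanSpace ℝ (Fin n), ‖x‖ = 1 ∧ T = power d x}}

/-- The normalized Lebesgue measure on the unit sphere of `ℝⁿ`. -/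
def sphereMeasure (n : ℕ) : Measure (Metric.sphere (0 : EuclideanSpace ℝ (Fin n)) 1) :=
  ((volume : Measure (EuclideanSpace ℝ (Fin n))).toSphere Set.univ)⁻¹ •
    (volume : Measure (EuclideanSpace ℝ (Fin n))).toSphere

/-- The sphere average of `x^{⊗ 2d}`. -/
def sphereAverage (d n : ℕ) : Tensor ℝ (Modes d) n :=
  ∫ x : Metric.sphere (0 : EuclideanSpace ℝ (Fin n)) 1, power d x.1 ∂(sphereMeasure n)

/-- The unit ball of the nuclear norm in the space of real symmetric tensors of order `2d`. -/
def nucBall (d n : ℕ) : Set (Tensor ℝ (Modes d) n) :=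
  {B | B ∈ symTensors ℝ (Modes d) n ∧ nucNorm B ≤ 1}

/-- `F` is a face of `C`: a convex extreme subset. -/
def IsFace {E : Type} [AddCommGroup E] [Module ℝ E] (C F : Set E) : Prop :=
  Convex ℝ F ∧ IsExtreme ℝ C F

/-- The affine dimension of a set. -/
def affDim {E : Type} [AddCommGroup E] [Module ℝ E] (F : Set E) : ℕ :=
  Module.finrank ℝ (vectorSpan ℝ F)

end SymDensity

end

/-! Everything about the nuclear norm rests on the pairing functionals `pairTrace ω`, which contract
the 2d modes in the d pairs chosen by a permutation ω. By Cauchy–Schwarz they are at most 1 in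
modulus on product states, and on a symmetric tensor they all equal the trace. So if a symmetric R
of trace one lies in the convex hull of the product states, every product state carrying positive
weight has all its pairings equal to 1. Equality in Cauchy–Schwarz then makes any two factors
conjugate up to a scalar, and three modes force all factors onto one real line: the state is a power
x^{⊗2d} (`exists_power_of_pairTrace_eq_one`). The argument works over ℝ (unit ball of the nuclear
norm) and over ℂ (separability), which yields both equivalences and shows that the hyperplane tr = 1
cuts out the face.

The powers span the symmetric tensors and have trace 1, so the face has codimension one in that
space; no proper face can be larger, since a face whose directions fill the space contains a
relative interior point that absorbs the whole ball.

For the spectral norm, pairing with R* is c·tr on symmetric tensors (check on powers), so ⟨R,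
x^{⊗2d}⟩ has sphere average c, at most the spectral norm. Equality makes this form constant on the
sphere, hence R = R*. That R* attains c follows from the arithmetic-geometric mean inequality, and c
itself from Gaussian integrals in polar coordinates. The upper bounds come from ‖R‖ ≤ 1. -/

/-! ### Convex hulls in finite dimension -/

/-- In a finite-dimensional space the convex hull of a compact set is compact. -/
theorem isCompact_convexHull_of_finiteDimensional {E : Type} [NormedAddCommGroup E]
    [NormedSpace ℝ E] [FiniteDimensional ℝ E] {s : Set E} (hs : IsCompact s) :
    IsCompact (convexHull ℝ s) := by
  rcases s.eq_empty_or_nonempty with rfl | ⟨s₀, hs₀⟩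
  · simp
  -- Carathéodory: N points suffice, so the hull is a continuous image of a simplex times N copies
  -- of `s`.
  set N := Module.finrank ℝ E + 1
  have hK : IsCompact (stdSimplex ℝ (Fin N) ×ˢ Set.univ.pi fun _ : Fin N => s) :=
    (isCompact_stdSimplex ℝ (Fin N)).prod (isCompact_univ_pi fun _ => hs)
  have hf : Continuous fun p : (Fin N → ℝ) × (Fin N → E) => ∑ k, p.1 k • p.2 k := by fun_prop
  convert hK.image hf using 1
  apply Set.Subset.antisymm
  · intro x hx
    obtain ⟨κ, _, z, w, hz, hind, hw, hw1, rfl⟩ := eq_pos_convex_span_of_mem_convexHull hx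
    have hcard : Fintype.card κ ≤ Fintype.card (Fin N) := by
      rw [Fintype.card_fin]
      exact hind.card_le_finrank_succ.trans (Nat.succ_le_succ (Submodule.finrank_le _))
    obtain ⟨e⟩ := Function.Embedding.nonempty_of_card_le hcard
    have hsum : ∀ {M : Type} [AddCommMonoid M] (f : κ → M),
        ∑ k, Function.extend e f 0 k = ∑ i, f i := by
      intro M _ f
      rw [← Finset.sum_subset (Finset.subset_univ (Finset.univ.map e))]
      · simp [e.injective.extend_apply]
      · intro k _ hk
        rw [Function.extend_apply' _ _ _ (by simpa using hk)]
        rfl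
    -- Shorter combinations are padded with weight 0 at the point `s₀`.
    refine ⟨(Function.extend e w 0, Function.extend e z fun _ => s₀), ⟨⟨fun k => ?_, ?_⟩, ?_⟩, ?_⟩
    · by_cases hk : ∃ i, e i = k
      · obtain ⟨i, rfl⟩ := hk
        simpa [e.injective.extend_apply] using (hw i).le
      · simp [Function.extend_apply' _ _ _ hk]
    · rw [← hw1]
      exact hsum w
    · intro k _
      by_cases hk : ∃ i, e i = k
      · obtain ⟨i, rfl⟩ := hk
        simpa [e.injective.extend_apply] using hz ⟨i, rfl⟩
      · simpa [Function.extend_apply' _ _ _ hk] using hs₀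
    · change ∑ k, Function.extend e w 0 k • Function.extend e z (fun _ => s₀) k = _
      rw [← hsum]
      refine Finset.sum_congr rfl fun k _ => ?_
      by_cases hk : ∃ i, e i = k
      · obtain ⟨i, rfl⟩ := hk
        simp [e.injective.extend_apply]
      · simp [Function.extend_apply' _ _ _ hk]
  · rintro _ ⟨⟨w, z⟩, ⟨hw, hz⟩, rfl⟩
    exact mem_convexHull_of_exists_fintype w z hw.1 hw.2 (fun i => hz i trivial) rfl

/-- A point of a convex hull at which a family of linear functionals attains an upper bound lies
in the convex hull of the points attaining all these bounds. -/
theorem mem_convexHull_sep_of_le {E ι : Type*} [AddCommGroup E] [Module ℝ E] {s : Set E}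
    (f : ι → E →ₗ[ℝ] ℝ) {c : ι → ℝ} (hs : ∀ i, ∀ y ∈ s, f i y ≤ c i) {x : E}
    (hx : x ∈ convexHull ℝ s) (hfx : ∀ i, f i x = c i) :
    x ∈ convexHull ℝ {y ∈ s | ∀ i, f i y = c i} := by
  obtain ⟨κ, _, w, z, hw, hw1, hz, rfl⟩ := mem_convexHull_iff_exists_fintype.1 hx
  have key : ∀ k, w k ≠ 0 → ∀ i, f i (z k) = c i := by
    intro k hk i
    -- The weighted sum of nonnegative gaps vanishes, hence each of its terms does.
    have h0 : ∑ k, w k * (c i - f i (z k)) = 0 := by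
      have := hfx i
      simp only [map_sum, map_smul, smul_eq_mul] at this
      simp only [mul_sub, Finset.sum_sub_distrib, this, ← Finset.sum_mul, hw1]
      ring
    have := (Finset.sum_eq_zero_iff_of_nonneg fun k _ =>
      mul_nonneg (hw k) (sub_nonneg.2 (hs i _ (hz k)))).1 h0 k (Finset.mem_univ k)
    rcases mul_eq_zero.1 this with h | h
    · exact absurd h hk
    · linarith
  classical
  rw [← Fintype.sum_subset (s := {k | w k ≠ 0})
    fun k hk => Finset.mem_filter.2 ⟨Finset.mem_univ _, left_ne_zero_of_smul hk⟩]
  refine (convex_convexHull ..).sum_mem (fun k _ => hw k)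
    (by rwa [Finset.sum_filter_ne_zero]) fun k hk => subset_convexHull _ _ ⟨hz k, ?_⟩
  exact key k (Finset.mem_filter.1 hk).2

set_option linter.unusedSectionVars false
set_option linter.unusedDecidableInType false
set_option linter.unusedFintypeInType false

/-! ### Product tensors and pairings of modes -/

namespace SymDensity

section General

variable {𝕜 : Type} [RCLike 𝕜] {ι : Type} [Fintype ι] [DecidableEq ι] {n : ℕ}

@[simp]
theorem outer_apply (x : ι → EuclideanSpace 𝕜 (Fin n)) (i : ι → Fin n) :
    outer x i = ∏ k, x k (i k) := rfl

theorem inner_outer_outer (x y : ι → EuclideanSpace 𝕜 (Fin n)) :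
    inner 𝕜 (outer x) (outer y) = ∏ k, inner 𝕜 (x k) (y k) := by
  simp only [PiLp.inner_apply, outer_apply, RCLike.inner_apply, map_prod,
    ← Finset.prod_mul_distrib]
  rw [Finset.prod_univ_sum]
  simp

theorem norm_outer (x : ι → EuclideanSpace 𝕜 (Fin n)) : ‖outer x‖ = ∏ k, ‖x k‖ := by
  have h := inner_outer_outer x x
  simp only [inner_self_eq_norm_sq_to_K] at h
  rw [Finset.prod_pow, ← map_prod, ← map_pow, ← map_pow, RCLike.ofReal_inj] at h
  exact (sq_eq_sq₀ (norm_nonneg _) (Finset.prod_nonneg fun _ _ => norm_nonneg _)).1 h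

theorem outer_smul (c : ι → 𝕜) (x : ι → EuclideanSpace 𝕜 (Fin n)) :
    outer (fun k => c k • x k) = (∏ k, c k) • outer x := by
  ext i
  simp [Finset.prod_mul_distrib]

theorem continuous_outer :
    Continuous (outer : (ι → EuclideanSpace 𝕜 (Fin n)) → Tensor 𝕜 ι n) := by
  unfold outer
  fun_prop

theorem isCompact_productStates : IsCompact (productStates 𝕜 ι n) := by
  have : productStates 𝕜 ι n =
      outer '' (Set.univ.pi fun _ : ι => Metric.sphere (0 : EuclideanSpace 𝕜 (Fin n)) 1) := by
    ext X
    simp only [productStates, Set.mem_ofPred_eq, Set.mem_image, Set.mem_pi, Set.mem_univ,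
      mem_sphere_zero_iff_norm, true_implies]
    exact exists_congr fun x => and_congr_right fun _ => eq_comm
  rw [this]
  exact (isCompact_univ_pi fun _ => isCompact_sphere _ _).image continuous_outer

theorem norm_eq_one_of_mem_productStates {X : Tensor 𝕜 ι n} (hX : X ∈ productStates 𝕜 ι n) :
    ‖X‖ = 1 := by
  obtain ⟨x, hx, rfl⟩ := hX
  simp [norm_outer, hx]

theorem productStates_nonempty (hn : 0 < n) : (productStates 𝕜 ι n).Nonempty :=
  ⟨_, fun _ => EuclideanSpace.single ⟨0, hn⟩ 1, by simp, rfl⟩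

theorem smul_mem_productStates [Nonempty ι] {X : Tensor 𝕜 ι n} (hX : X ∈ productStates 𝕜 ι n)
    {c : 𝕜} (hc : ‖c‖ = 1) : c • X ∈ productStates 𝕜 ι n := by
  obtain ⟨x, hx, rfl⟩ := hX
  refine ⟨fun k => (if k = Classical.arbitrary ι then c else 1) • x k, fun k => ?_, ?_⟩
  · rw [norm_smul, hx]
    split_ifs <;> simp [hc]
  · rw [outer_smul]
    simp

/-- Every tensor product of vectors is a nonnegative multiple of a product state. -/
theorem exists_productState_smul (hn : 0 < n) (x : ι → EuclideanSpace 𝕜 (Fin n)) :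
    ∃ Y ∈ productStates 𝕜 ι n, outer x = (‖outer x‖ : 𝕜) • Y := by
  have h : ∀ k, ∃ y : EuclideanSpace 𝕜 (Fin n), ‖y‖ = 1 ∧ x k = (‖x k‖ : 𝕜) • y := by
    intro k
    by_cases hk : x k = 0
    · exact ⟨EuclideanSpace.single ⟨0, hn⟩ 1, by simp, by simp [hk]⟩
    · refine ⟨(‖x k‖⁻¹ : 𝕜) • x k, ?_, ?_⟩
      · rw [norm_smul]
        simp [hk]
      · rw [smul_smul, mul_inv_cancel₀ (by simpa using hk), one_smul]
  choose y hy hxy using h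
  refine ⟨outer y, ⟨y, hy, rfl⟩, ?_⟩
  rw [norm_outer, RCLike.ofReal_prod, ← outer_smul]
  congr 1
  exact funext hxy

/-- Evaluation of `X` on the pairing of modes determined by `ω`. -/
def pairTrace {d : ℕ} (ω : Equiv.Perm (Modes d)) : Tensor 𝕜 (Modes d) n →ₗ[𝕜] 𝕜 where
  toFun X := ∑ i : Fin d → Fin n, X (Sum.elim i i ∘ ω)
  map_add' := by simp [Finset.sum_add_distrib]
  map_smul' := by simp [Finset.mul_sum]

theorem pairTrace_apply {d : ℕ} (ω : Equiv.Perm (Modes d)) (X : Tensor 𝕜 (Modes d) n) :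
    pairTrace ω X = ∑ i : Fin d → Fin n, X (Sum.elim i i ∘ ω) := rfl

theorem pairTrace_one {d : ℕ} (X : Tensor 𝕜 (Modes d) n) : pairTrace 1 X = tensorTrace X := rfl

theorem pairTrace_of_mem_symTensors {d : ℕ} {X : Tensor 𝕜 (Modes d) n}
    (hX : X ∈ symTensors 𝕜 (Modes d) n) (ω : Equiv.Perm (Modes d)) :
    pairTrace ω X = tensorTrace X :=
  Finset.sum_congr rfl fun _ _ => hX ω _

theorem pairTrace_outer {d : ℕ} (ω : Equiv.Perm (Modes d))
    (y : Modes d → EuclideanSpace 𝕜 (Fin n)) :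
    pairTrace ω (outer y) =
      ∏ k, ∑ a, y (ω.symm (Sum.inl k)) a * y (ω.symm (Sum.inr k)) a := by
  rw [Finset.prod_univ_sum]
  simp only [pairTrace_apply, outer_apply, Fintype.piFinset_univ]
  refine Finset.sum_congr rfl fun i _ => ?_
  rw [← Equiv.prod_comp ω.symm, Fintype.prod_sum_type, ← Finset.prod_mul_distrib]
  simp

/-- The entrywise conjugate of a vector. -/
def conjVec (u : EuclideanSpace 𝕜 (Fin n)) : EuclideanSpace 𝕜 (Fin n) :=
  WithLp.toLp 2 fun a => conj (u a)

@[simp]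
theorem conjVec_apply (u : EuclideanSpace 𝕜 (Fin n)) (a : Fin n) : conjVec u a = conj (u a) := rfl

@[simp]
theorem norm_conjVec (u : EuclideanSpace 𝕜 (Fin n)) : ‖conjVec u‖ = ‖u‖ := by
  simp [EuclideanSpace.norm_eq]

/-- The contraction is bilinear, not Hermitian; conjugating one factor gives access to
Cauchy–Schwarz. -/
theorem sum_mul_eq_inner_conjVec (u v : EuclideanSpace 𝕜 (Fin n)) :
    ∑ a, u a * v a = inner 𝕜 (conjVec u) v := by
  simp [PiLp.inner_apply, mul_comm]

theorem norm_sum_mul_le (u v : EuclideanSpace 𝕜 (Fin n)) : ‖∑ a, u a * v a‖ ≤ ‖u‖ * ‖v‖ := by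
  rw [sum_mul_eq_inner_conjVec]
  simpa using norm_inner_le_norm (𝕜 := 𝕜) (conjVec u) v

/-- Cauchy–Schwarz in each pair; every mode lies in exactly one pair, so the bounds multiply to the
full norm. -/
theorem norm_pairTrace_outer_le {d : ℕ} (ω : Equiv.Perm (Modes d))
    (y : Modes d → EuclideanSpace 𝕜 (Fin n)) : ‖pairTrace ω (outer y)‖ ≤ ‖outer y‖ := by
  rw [pairTrace_outer, norm_outer, norm_prod, ← Equiv.prod_comp ω.symm, Fintype.prod_sum_type,
    ← Finset.prod_mul_distrib]
  exact Finset.prod_le_prod (fun _ _ => norm_nonneg _) fun _ _ => norm_sum_mul_le _ _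

/-- Used to make two prescribed modes one of the contracted pairs. -/
theorem exists_perm_symm_apply {α : Type*} [DecidableEq α] {a b p q : α} (hab : a ≠ b)
    (hpq : p ≠ q) : ∃ ω : Equiv.Perm α, ω.symm a = p ∧ ω.symm b = q := by
  let σ := Equiv.swap a p
  have hσ : σ a = p := Equiv.swap_apply_left a p
  have hb : p ≠ σ b := fun h => hab (σ.injective (hσ.trans h))
  refine ⟨(σ.trans (Equiv.swap (σ b) q)).symm, ?_, ?_⟩
  · simp [hσ, Equiv.swap_apply_of_ne_of_ne hb hpq]
  · simp

/-- A real tensor with its entries regarded as elements of `𝕜`. -/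
def castTensor (𝕜 : Type) [RCLike 𝕜] : Tensor ℝ ι n →ₗ[ℝ] Tensor 𝕜 ι n where
  toFun R := WithLp.toLp 2 fun i => (R i : 𝕜)
  map_add' X Y := by ext; simp
  map_smul' c X := by ext; simp [RCLike.real_smul_eq_coe_mul]

@[simp]
theorem castTensor_apply (R : Tensor ℝ ι n) (i : ι → Fin n) : castTensor 𝕜 R i = (R i : 𝕜) := rfl

theorem castTensor_injective : Function.Injective (castTensor 𝕜 : Tensor ℝ ι n → _) := by
  intro X Y h
  ext i
  exact RCLike.ofReal_injective (K := 𝕜) (congrArg (fun Z : Tensor 𝕜 ι n => Z i) h)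

theorem castTensor_real (R : Tensor ℝ ι n) : castTensor ℝ R = R := by
  ext i
  simp

theorem castTensor_mem_symTensors {R : Tensor ℝ ι n} (hR : R ∈ symTensors ℝ ι n) :
    castTensor 𝕜 R ∈ symTensors 𝕜 ι n := by
  intro ω i
  simp [hR ω i]

/-- A unit vector proportional to its conjugate is a phase times a real unit vector. -/
theorem exists_phase_smul_real {u : EuclideanSpace 𝕜 (Fin n)} (hu : ‖u‖ = 1) {c : 𝕜}
    (hc : u = c • conjVec u) :
    ∃ (ζ : 𝕜) (x : EuclideanSpace ℝ (Fin n)), ‖ζ‖ = 1 ∧ ‖x‖ = 1 ∧ ∀ a, u a = ζ * (x a : 𝕜) := by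
  obtain ⟨a, ha⟩ : ∃ a, u a ≠ 0 := by
    by_contra! h
    have : u = 0 := by ext a; simp [h a]
    simp [this] at hu
  have hca : ∀ b, u b = c * conj (u b) := fun b =>
    congrArg (fun v : EuclideanSpace 𝕜 (Fin n) => v b) hc
  -- Both sides equal c · conj(u a) · conj(u b), so dividing by the phase of the nonzero entry u a
  -- leaves real entries.
  have hreal : ∀ b, conj (u b * conj (u a)) = u b * conj (u a) := by
    intro b
    rw [map_mul, RCLike.conj_conj]
    conv_lhs => rw [hca a]
    conv_rhs => rw [hca b]
    ring
  have hna : (‖u a‖ : 𝕜) ≠ 0 := by simpa using ha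
  set ζ : 𝕜 := u a / ‖u a‖ with hζ
  have hζ1 : ‖ζ‖ = 1 := by simp [hζ, ha]
  set x : EuclideanSpace ℝ (Fin n) :=
    WithLp.toLp 2 fun b => RCLike.re (u b * conj (u a)) / ‖u a‖ with hx
  have hux : ∀ b, u b = ζ * (x b : 𝕜) := by
    intro b
    have h1 : (x b : 𝕜) = u b * conj (u a) / ‖u a‖ := by
      simp only [hx, RCLike.ofReal_div]
      rw [RCLike.conj_eq_iff_re.1 (hreal b)]
    rw [h1, hζ, div_mul_div_comm, mul_left_comm, RCLike.mul_conj]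
    field_simp
  refine ⟨ζ, x, hζ1, ?_, hux⟩
  rw [← hu, EuclideanSpace.norm_eq, EuclideanSpace.norm_eq]
  congr 1
  refine Finset.sum_congr rfl fun b _ => ?_
  rw [hux b, norm_mul, hζ1, one_mul, RCLike.norm_ofReal, Real.norm_eq_abs]

/-- A product state whose pairings are all equal to one is the power of a real unit vector. -/
theorem exists_power_of_pairTrace_eq_one {d : ℕ} (hd : 2 ≤ d)
    {y : Modes d → EuclideanSpace 𝕜 (Fin n)} (hy : ∀ k, ‖y k‖ = 1)
    (h : ∀ ω, pairTrace ω (outer y) = 1) :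
    ∃ x : EuclideanSpace ℝ (Fin n), ‖x‖ = 1 ∧ outer y = castTensor 𝕜 (power d x) := by
  have hpair : ∀ p q, p ≠ q → ∃ c : 𝕜, y q = c • conjVec (y p) := by
    intro p q hpq
    let k₀ : Fin d := ⟨0, by omega⟩
    obtain ⟨ω, hp, hq⟩ := exists_perm_symm_apply (a := Sum.inl k₀) (b := Sum.inr k₀)
      (by simp) hpq
    have h1 := congrArg norm (h ω)
    rw [pairTrace_outer, norm_prod, norm_one] at h1
    have hle : ∀ k ∈ Finset.univ, ‖∑ a, y (ω.symm (Sum.inl k)) a * y (ω.symm (Sum.inr k)) a‖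
        ≤ (1 : ℝ) := fun k _ => by
      simpa [hy] using norm_sum_mul_le (y (ω.symm (Sum.inl k))) (y (ω.symm (Sum.inr k)))
    -- A product of factors of modulus at most 1 has modulus 1, so the factor of the pair (p, q)
    -- does too.
    have h2 : ‖∑ a, y p a * y q a‖ = 1 := by
      refine le_antisymm (by simpa [hy] using norm_sum_mul_le (y p) (y q)) ?_
      rw [← h1, ← Finset.mul_prod_erase _ _ (Finset.mem_univ k₀), hp, hq]
      exact mul_le_of_le_one_right (norm_nonneg _)
        (Finset.prod_le_one (fun _ _ => norm_nonneg _) fun k _ => hle k (Finset.mem_univ k))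
    rw [sum_mul_eq_inner_conjVec] at h2
    have hne : ∀ {v : EuclideanSpace 𝕜 (Fin n)}, ‖v‖ = 1 → v ≠ 0 := fun hv h0 => by
      simp [h0] at hv
    obtain ⟨r, -, hr⟩ := (norm_inner_eq_norm_iff (𝕜 := 𝕜) (x := conjVec (y p)) (y := y q)
      (hne (by simp [hy])) (hne (hy q))).1 (by simp [h2, hy])
    exact ⟨r, hr⟩
  have hconj : ∀ (c : 𝕜) (v : EuclideanSpace 𝕜 (Fin n)),
      conjVec (c • conjVec v) = conj c • v := by
    intro c v
    ext a
    simp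
  -- Three distinct modes exist because d ≥ 2. Three conjugations around the cycle p, q, r relate `y
  -- p` to its own conjugate.
  let p : Modes d := Sum.inl ⟨0, by omega⟩
  let q : Modes d := Sum.inl ⟨1, by omega⟩
  let r : Modes d := Sum.inr ⟨0, by omega⟩
  obtain ⟨c₁, h₁⟩ := hpair p q (by simp [p, q])
  obtain ⟨c₂, h₂⟩ := hpair q r (by simp [q, r])
  obtain ⟨c₃, h₃⟩ := hpair r p (by simp [p, r])
  have hself : y p = (c₃ * (conj c₂ * c₁)) • conjVec (y p) := by
    rw [h₂, hconj, h₁, smul_smul, smul_smul, mul_assoc] at h₃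
    exact h₃
  obtain ⟨ζ, x, -, hx, hux⟩ := exists_phase_smul_real (hy p) hself
  have hall : ∀ k, ∃ c : 𝕜, ∀ a, y k a = c * (x a : 𝕜) := by
    intro k
    by_cases hk : p = k
    · exact ⟨ζ, by rw [← hk]; exact hux⟩
    · obtain ⟨c, hc⟩ := hpair p k hk
      refine ⟨c * conj ζ, fun a => ?_⟩
      rw [hc]
      simp [hux, mul_assoc]
  choose c hc using hall
  have hout : outer y = (∏ k, c k) • castTensor 𝕜 (power d x) := by
    ext i
    simp [power, hc, Finset.prod_mul_distrib]
  have htr : pairTrace 1 (castTensor 𝕜 (power d x)) = (1 : 𝕜) := by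
    have : castTensor 𝕜 (power d x) =
        outer fun _ : Modes d => (WithLp.toLp 2 fun a => (x a : 𝕜) : EuclideanSpace 𝕜 (Fin n)) := by
      ext i
      simp [power]
    rw [this, pairTrace_outer]
    refine Finset.prod_eq_one fun k _ => ?_
    have h2 : ∑ a, x a * x a = 1 := by
      have := EuclideanSpace.real_norm_sq_eq x
      rw [hx] at this
      simpa [sq] using this.symm
    simpa using congrArg (RCLike.ofReal (K := 𝕜)) h2
  -- The scalar left over from the factors is 1, because both traces are.
  have h1 := h 1
  rw [hout, map_smul, htr, smul_eq_mul, mul_one] at h1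
  exact ⟨x, hx, by rw [hout, h1, one_smul]⟩

/-- A symmetric tensor of trace one in the convex hull of the product states is a convex
combination of powers of real unit vectors. -/
theorem mem_convexHull_power_of_mem_convexHull_productStates {d : ℕ} (hd : 2 ≤ d)
    {R : Tensor 𝕜 (Modes d) n} (hR : R ∈ symTensors 𝕜 (Modes d) n) (htr : tensorTrace R = 1)
    (hconv : R ∈ convexHull ℝ (productStates 𝕜 (Modes d) n)) :
    R ∈ convexHull ℝ
      {T | ∃ x : EuclideanSpace ℝ (Fin n), ‖x‖ = 1 ∧ T = castTensor 𝕜 (power d x)} := by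
  have hle : ∀ (ω : Equiv.Perm (Modes d)), ∀ Y ∈ productStates 𝕜 (Modes d) n,
      ‖pairTrace ω Y‖ ≤ 1 := by
    intro ω Y hY
    rw [← norm_eq_one_of_mem_productStates hY]
    obtain ⟨y, -, rfl⟩ := hY
    exact norm_pairTrace_outer_le ω y
  have := mem_convexHull_sep_of_le (s := productStates 𝕜 (Modes d) n) (c := fun _ => 1)
    (fun ω => RCLike.reLm ∘ₗ (pairTrace ω).restrictScalars ℝ)
    (fun ω Y hY => (RCLike.re_le_norm _).trans (hle ω Y hY)) hconv
    (fun ω => by simp [pairTrace_of_mem_symTensors hR, htr])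
  refine convexHull_mono ?_ this
  rintro Y ⟨hY, h⟩
  -- Real part 1 and modulus at most 1 leave only the value 1.
  have h1 : ∀ ω, pairTrace ω Y = 1 := by
    intro ω
    have hre : RCLike.re (pairTrace ω Y) = 1 := h ω
    have hn := hle ω Y hY
    rw [← RCLike.re_eq_self_of_le (hn.trans hre.ge), hre, RCLike.ofReal_one]
  obtain ⟨y, hy, rfl⟩ := hY
  exact exists_power_of_pairTrace_eq_one hd hy h1

end General

end SymDensity

/-! ### Nuclear and spectral norms -/

namespace SymDensity

section Nuclear

variable {ι : Type} [Fintype ι] [DecidableEq ι] {n : ℕ}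

/-- Vanishing terms can be dropped from a finite sum of tensor products of vectors. -/
theorem exists_rankOne_family {κ : Type} [Fintype κ] (y : κ → ι → EuclideanSpace ℝ (Fin n)) :
    ∃ (r : ℕ) (Z : Fin r → Tensor ℝ ι n), (∀ k, Z k ∈ rankOne ℝ ι n) ∧
      ∑ k, outer (y k) = ∑ k, Z k ∧ ∑ k, ‖outer (y k)‖ = ∑ k, ‖Z k‖ := by
  classical
  let e := (Fintype.equivFin {k // outer (y k) ≠ 0}).symm
  have hsum : ∀ {M : Type} [AddCommMonoid M] (f : Tensor ℝ ι n → M), f 0 = 0 →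
      ∑ k, f (outer (y k)) = ∑ k, f (outer (y (e k))) := by
    intro M _ f hf
    rw [Equiv.sum_comp e fun k : {k // outer (y k) ≠ 0} => f (outer (y k)),
      ← Finset.sum_subtype {k | outer (y k) ≠ 0} (by simp) fun k => f (outer (y k)),
      Finset.sum_filter]
    refine Finset.sum_congr rfl fun k _ => ?_
    split_ifs with h
    · rfl
    · rw [not_not.1 h, hf]
  exact ⟨_, fun k => outer (y (e k)), fun k => ⟨(e k).2, _, rfl⟩, hsum id rfl,
    hsum norm norm_zero⟩

theorem bddBelow_nucNorm (X : Tensor ℝ ι n) :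
    BddBelow {t | ∃ (r : ℕ) (Z : Fin r → Tensor ℝ ι n),
      (∀ k, Z k ∈ rankOne ℝ ι n) ∧ X = ∑ k, Z k ∧ t = ∑ k, ‖Z k‖} :=
  ⟨0, by rintro _ ⟨r, Z, -, -, rfl⟩; positivity⟩

theorem nucNorm_sum_outer_le {κ : Type} [Fintype κ] (y : κ → ι → EuclideanSpace ℝ (Fin n)) :
    nucNorm (∑ k, outer (y k)) ≤ ∑ k, ‖outer (y k)‖ := by
  obtain ⟨r, Z, hZ, h1, h2⟩ := exists_rankOne_family y
  exact csInf_le (bddBelow_nucNorm _) ⟨r, Z, hZ, h1, h2⟩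

/-- Expansion in the standard basis, with each coefficient absorbed into the single mode `k₀`. -/
theorem eq_sum_outer [Nonempty ι] (X : Tensor ℝ ι n) : ∃ y : (ι → Fin n) → ι →
    EuclideanSpace ℝ (Fin n), X = ∑ i, outer (y i) ∧ ∀ i, ‖outer (y i)‖ = |X i| := by
  let k₀ := Classical.arbitrary ι
  refine ⟨fun i k => (if k = k₀ then X i else 1) • EuclideanSpace.single (i k) 1, ?_, fun i => ?_⟩
  · ext j
    simp only [outer_smul]
    have : ∀ i : ι → Fin n, (∏ k, if j k = i k then (1 : ℝ) else 0) = if j = i then 1 else 0 := by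
      intro i
      split_ifs with h
      · simp [h]
      · obtain ⟨k, hk⟩ := Function.ne_iff.1 h
        exact Finset.prod_eq_zero (Finset.mem_univ k) (by simp [hk])
    simp [this, WithLp.ofLp_sum]
  · rw [outer_smul, norm_smul, norm_outer]
    simp

theorem nucNorm_le_sum_abs [Nonempty ι] (X : Tensor ℝ ι n) : nucNorm X ≤ ∑ i, |X i| := by
  obtain ⟨y, hX, hy⟩ := eq_sum_outer X
  conv_lhs => rw [hX]
  exact (nucNorm_sum_outer_le y).trans_eq (Finset.sum_congr rfl fun i _ => hy i)

theorem nonempty_nucNorm [Nonempty ι] (X : Tensor ℝ ι n) :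
    {t | ∃ (r : ℕ) (Z : Fin r → Tensor ℝ ι n),
      (∀ k, Z k ∈ rankOne ℝ ι n) ∧ X = ∑ k, Z k ∧ t = ∑ k, ‖Z k‖}.Nonempty := by
  obtain ⟨y, hX, -⟩ := eq_sum_outer X
  obtain ⟨r, Z, hZ, h1, -⟩ := exists_rankOne_family y
  exact ⟨_, r, Z, hZ, hX.trans h1, rfl⟩

theorem nucNorm_nonneg (X : Tensor ℝ ι n) : 0 ≤ nucNorm X :=
  Real.sInf_nonneg (by rintro _ ⟨r, Z, -, -, rfl⟩; positivity)

theorem nucNorm_smul_le [Nonempty ι] {c : ℝ} (hc : 0 < c) (X : Tensor ℝ ι n) :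
    nucNorm (c • X) ≤ c * nucNorm X := by
  rw [← div_le_iff₀' hc]
  refine le_csInf (nonempty_nucNorm X) ?_
  rintro _ ⟨r, Z, hZ, rfl, rfl⟩
  rw [div_le_iff₀' hc]
  choose h0 y hy using hZ
  have : ∀ k, ∃ z : ι → EuclideanSpace ℝ (Fin n), c • Z k = outer z := by
    intro k
    refine ⟨fun l => (if l = Classical.arbitrary ι then c else 1) • y k l, ?_⟩
    rw [outer_smul, hy k]
    simp
  choose z hz using this
  have h := nucNorm_sum_outer_le z
  simpa [← hz, norm_smul, abs_of_pos hc, Finset.smul_sum, Finset.mul_sum] using h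

theorem le_nucNorm_of_le [Nonempty ι] (f : Tensor ℝ ι n →ₗ[ℝ] ℝ)
    (hf : ∀ y, f (outer y) ≤ ‖outer y‖) (X : Tensor ℝ ι n) : f X ≤ nucNorm X := by
  refine le_csInf (nonempty_nucNorm X) ?_
  rintro _ ⟨r, Z, hZ, rfl, rfl⟩
  rw [map_sum]
  refine Finset.sum_le_sum fun k _ => ?_
  obtain ⟨-, y, hy⟩ := hZ k
  rw [hy]
  exact hf y

/-- The unit ball of the nuclear norm is the convex hull of the product states. -/
theorem nucNorm_le_one_iff [Nonempty ι] (hn : 0 < n) {X : Tensor ℝ ι n} :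
    nucNorm X ≤ 1 ↔ X ∈ convexHull ℝ (productStates ℝ ι n) := by
  constructor
  · intro h
    -- The origin is the midpoint of Y and -Y; it will take up the missing weight below.
    have hzero : (0 : Tensor ℝ ι n) ∈ convexHull ℝ (productStates ℝ ι n) := by
      obtain ⟨Y, hY⟩ := productStates_nonempty (𝕜 := ℝ) (ι := ι) hn
      have hY' := smul_mem_productStates hY (c := (-1 : ℝ)) (by simp)
      have := (convex_convexHull ℝ (productStates ℝ ι n)) (subset_convexHull _ _ hY)
        (subset_convexHull _ _ hY') (a := 1 / 2) (b := 1 / 2) (by norm_num) (by norm_num)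
        (by norm_num)
      simpa using this
    have hclosed : IsClosed (convexHull ℝ (productStates ℝ ι n)) :=
      (isCompact_convexHull_of_finiteDimensional isCompact_productStates).isClosed
    -- Decompositions only approach the infimum, so X is shrunk by 1 + ε and recovered from
    -- closedness of the hull.
    have hmem : ∀ ε : ℝ, 0 < ε → (1 + ε)⁻¹ • X ∈ convexHull ℝ (productStates ℝ ι n) := by
      intro ε hε
      obtain ⟨_, ⟨r, Z, hZ, rfl, rfl⟩, hlt⟩ :=
        exists_lt_of_csInf_lt (nonempty_nucNorm X) (show nucNorm X < 1 + ε by linarith)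
      have : ∀ k, ∃ Y ∈ productStates ℝ ι n, Z k = ‖Z k‖ • Y := by
        intro k
        obtain ⟨-, y, hy⟩ := hZ k
        rw [hy]
        exact exists_productState_smul hn y
      choose Y hY hZY using this
      have h1 : (1 + ε)⁻¹ • ∑ k, Z k =
          ∑ k, ((1 + ε)⁻¹ * ‖Z k‖) • Y k + (1 - (1 + ε)⁻¹ * ∑ k, ‖Z k‖) • (0 : Tensor ℝ ι n) := by
        rw [smul_zero, add_zero, Finset.smul_sum]
        exact Finset.sum_congr rfl fun k _ => by rw [mul_smul, ← hZY]
      have h2 : (1 + ε)⁻¹ * ∑ k, ‖Z k‖ ≤ 1 := by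
        rw [inv_mul_le_iff₀ (by linarith)]
        linarith
      have h3 := (convex_convexHull ℝ (productStates ℝ ι n)).sum_mem
        (t := Finset.univ) (w := fun o : Option (Fin r) =>
          o.elim (1 - (1 + ε)⁻¹ * ∑ k, ‖Z k‖) fun k => (1 + ε)⁻¹ * ‖Z k‖)
        (z := fun o => o.elim 0 Y) ?_ ?_ ?_
      · rw [h1, add_comm]
        simpa [Fintype.sum_option] using h3
      · rintro (_ | k) -
        · simpa using h2
        · exact mul_nonneg (by positivity) (norm_nonneg _)
      · simp [Fintype.sum_option, Finset.mul_sum]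
      · rintro (_ | k) -
        · exact hzero
        · exact subset_convexHull _ _ (hY k)
    have hlim : Filter.Tendsto (fun ε : ℝ => (1 + ε)⁻¹ • X) (nhdsWithin 0 (Set.Ioi 0)) (nhds X) := by
      have : ContinuousAt (fun ε : ℝ => (1 + ε)⁻¹ • X) 0 := by
        refine ContinuousAt.smul (f := fun ε : ℝ => (1 + ε)⁻¹) (g := fun _ => X)
          (ContinuousAt.inv₀ (f := fun ε : ℝ => 1 + ε) (by fun_prop) (by norm_num))
          continuousAt_const
      have h := this.tendsto
      simp only [add_zero, inv_one, one_smul] at h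
      exact h.mono_left nhdsWithin_le_nhds
    exact hclosed.mem_of_tendsto hlim (eventually_mem_nhdsWithin.mono fun ε hε => hmem ε hε)
  · intro h
    obtain ⟨κ, _, w, Y, hw, hw1, hY, rfl⟩ := mem_convexHull_iff_exists_fintype.1 h
    have : ∀ k, ∃ z : ι → EuclideanSpace ℝ (Fin n), w k • Y k = outer z := by
      intro k
      obtain ⟨y, -, hy⟩ := hY k
      refine ⟨fun l => (if l = Classical.arbitrary ι then w k else 1) • y l, ?_⟩
      rw [outer_smul, hy]
      simp
    choose z hz using this
    have h := nucNorm_sum_outer_le z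
    simpa [← hz, norm_smul, norm_eq_one_of_mem_productStates (hY _), hw1,
      abs_of_nonneg (hw _)] using h

theorem le_betaSym [Nonempty ι] {X : Tensor ℝ ι n} (hX : X ∈ symTensors ℝ ι n) (h1 : ‖X‖ = 1) :
    nucNorm X ≤ betaSym ℝ ι n := by
  -- Entries of a unit tensor are at most 1 in modulus, so their number bounds the set whose
  -- supremum is taken.
  refine le_csSup ⟨∑ _i : ι → Fin n, 1, ?_⟩ ⟨X, hX, h1, rfl⟩
  rintro _ ⟨Y, -, hY, rfl⟩
  refine (nucNorm_le_sum_abs Y).trans (Finset.sum_le_sum fun i _ => ?_)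
  rw [← hY, ← Real.norm_eq_abs]
  exact PiLp.norm_apply_le Y i

theorem nucNorm_le_betaSym [Nonempty ι] {X : Tensor ℝ ι n} (hX : X ∈ symTensors ℝ ι n)
    (h0 : X ≠ 0) (h1 : ‖X‖ ≤ 1) : nucNorm X ≤ betaSym ℝ ι n := by
  have hpos : 0 < ‖X‖ := norm_pos_iff.2 h0
  have h := nucNorm_smul_le hpos (‖X‖⁻¹ • X)
  rw [smul_smul, mul_inv_cancel₀ hpos.ne', one_smul] at h
  refine h.trans ((mul_le_of_le_one_left (nucNorm_nonneg _) h1).trans (le_betaSym ?_ ?_))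
  · exact (symTensors ℝ ι n).smul_mem _ hX
  · rw [norm_smul, norm_inv, norm_norm, inv_mul_cancel₀ hpos.ne']

theorem bddAbove_specNorm (X : Tensor ℝ ι n) :
    BddAbove {t | ∃ Y ∈ productStates ℝ ι n, t = ‖inner ℝ Y X‖} := by
  refine ⟨‖X‖, ?_⟩
  rintro _ ⟨Y, hY, rfl⟩
  simpa [norm_eq_one_of_mem_productStates hY] using norm_inner_le_norm (𝕜 := ℝ) Y X

theorem le_specNorm (X : Tensor ℝ ι n) {Y : Tensor ℝ ι n} (hY : Y ∈ productStates ℝ ι n) :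
    ‖inner ℝ Y X‖ ≤ specNorm X :=
  le_csSup (bddAbove_specNorm X) ⟨Y, hY, rfl⟩

theorem specNorm_le (hn : 0 < n) {X : Tensor ℝ ι n} {c : ℝ}
    (h : ∀ Y ∈ productStates ℝ ι n, ‖inner ℝ Y X‖ ≤ c) : specNorm X ≤ c := by
  obtain ⟨Y, hY⟩ := productStates_nonempty (𝕜 := ℝ) (ι := ι) hn
  refine csSup_le ⟨_, Y, hY, rfl⟩ ?_
  rintro _ ⟨Y, hY, rfl⟩
  exact h Y hY

theorem specNorm_le_norm (hn : 0 < n) (X : Tensor ℝ ι n) : specNorm X ≤ ‖X‖ :=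
  specNorm_le hn fun Y hY => by
    simpa [norm_eq_one_of_mem_productStates hY] using norm_inner_le_norm (𝕜 := ℝ) Y X

theorem exists_specNorm_eq (hn : 0 < n) (X : Tensor ℝ ι n) :
    ∃ Y ∈ productStates ℝ ι n, specNorm X = ‖inner ℝ Y X‖ := by
  obtain ⟨Y, hY, hmax⟩ := isCompact_productStates.exists_isMaxOn
    (productStates_nonempty (𝕜 := ℝ) (ι := ι) hn)
    (f := fun Y : Tensor ℝ ι n => ‖inner ℝ Y X‖) (by fun_prop)
  exact ⟨Y, hY, le_antisymm (specNorm_le hn fun Z hZ => hmax hZ) (le_specNorm X hY)⟩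

/-- A tensor of norm at most one and spectral norm one is a product state. -/
theorem mem_productStates_of_specNorm_eq_one [Nonempty ι] (hn : 0 < n) {X : Tensor ℝ ι n}
    (h1 : ‖X‖ ≤ 1) (hs : specNorm X = 1) : X ∈ productStates ℝ ι n := by
  obtain ⟨Y, hY, h⟩ := exists_specNorm_eq hn X
  have hY1 := norm_eq_one_of_mem_productStates hY
  have hX1 : ‖X‖ = 1 := le_antisymm h1 (hs ▸ specNorm_le_norm hn X)
  have hne : ∀ {v : Tensor ℝ ι n}, ‖v‖ = 1 → v ≠ 0 := fun hv h0 => by simp [h0] at hv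
  -- Equality in Cauchy–Schwarz: X is a multiple of the maximizing state Y, by a scalar of modulus
  -- 1.
  obtain ⟨r, -, hr⟩ := (norm_inner_eq_norm_iff (𝕜 := ℝ) (hne hY1) (hne hX1)).1
    (by rw [← h, hs, hY1, hX1, one_mul])
  rw [hr]
  refine smul_mem_productStates hY ?_
  have := congrArg norm hr
  rw [norm_smul, hX1, hY1, mul_one] at this
  exact this.symm

end Nuclear

end SymDensity

/-! ### Dimensions of spans and of faces -/

/-- A set on which a linear functional is constantly one spans one dimension more linearly than
affinely. -/
theorem finrank_span_eq_finrank_vectorSpan_add_one {E : Type*} [AddCommGroup E] [Module ℝ E]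
    [FiniteDimensional ℝ E] {s : Set E} (hs : s.Nonempty) (f : E →ₗ[ℝ] ℝ)
    (hf : ∀ x ∈ s, f x = 1) :
    Module.finrank ℝ (Submodule.span ℝ s) = Module.finrank ℝ (vectorSpan ℝ s) + 1 := by
  obtain ⟨p, hp⟩ := hs
  have hp0 : p ≠ 0 := by
    rintro rfl
    simpa using hf 0 hp
  have hsup : Submodule.span ℝ s = vectorSpan ℝ s ⊔ Submodule.span ℝ {p} := by
    apply le_antisymm
    · rw [Submodule.span_le]
      intro x hx
      rw [← sub_add_cancel x p]
      exact Submodule.add_mem_sup (vsub_mem_vectorSpan ℝ hx hp) (Submodule.mem_span_singleton_self p)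
    · refine sup_le ?_ ?_
      · rw [vectorSpan_def, Submodule.span_le]
        rintro _ ⟨x, hx, y, hy, rfl⟩
        exact Submodule.sub_mem _ (Submodule.subset_span hx) (Submodule.subset_span hy)
      · rw [Submodule.span_singleton_le_iff_mem]
        exact Submodule.subset_span hp
  have hker : vectorSpan ℝ s ≤ LinearMap.ker f := by
    rw [vectorSpan_def, Submodule.span_le]
    rintro _ ⟨x, hx, y, hy, rfl⟩
    simp [hf x hx, hf y hy]
  -- `f` kills the directions of `s` but not `p`, so the sum is direct.
  have hinf : vectorSpan ℝ s ⊓ Submodule.span ℝ {p} = ⊥ := by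
    rw [Submodule.eq_bot_iff]
    rintro x ⟨hx, hxp⟩
    obtain ⟨c, rfl⟩ := Submodule.mem_span_singleton.1 hxp
    have : f (c • p) = 0 := hker hx
    rw [map_smul, hf p hp, smul_eq_mul, mul_one] at this
    rw [this, zero_smul]
  have h := Submodule.finrank_sup_add_finrank_inf_eq (vectorSpan ℝ s) (Submodule.span ℝ {p})
  rw [hinf, finrank_bot, finrank_span_singleton hp0, ← hsup] at h
  simpa using h

/-- A convex extreme subset whose directions contain the whole set is the whole set. -/
theorem IsExtreme.eq_of_le_vectorSpan {E : Type*} [NormedAddCommGroup E] [NormedSpace ℝ E]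
    [FiniteDimensional ℝ E] {C F : Set E} (hF : IsExtreme ℝ C F) (hconv : Convex ℝ F)
    (hne : F.Nonempty) (hspan : C ⊆ (vectorSpan ℝ F : Set E)) : F = C := by
  refine hF.subset.antisymm fun c hc => ?_
  obtain ⟨z, hz⟩ := Set.Nonempty.intrinsicInterior hconv hne
  have hzF := intrinsicInterior_subset hz
  obtain ⟨z', hz', rfl⟩ := mem_intrinsicInterior.1 hz
  have hdir : (z' : E) - c ∈ (affineSpan ℝ F).direction := by
    rw [direction_affineSpan]
    exact Submodule.sub_mem _ (hspan (hF.subset hzF)) (hspan hc)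
  -- The segment from c to the relative interior point z is prolonged slightly beyond z inside F;
  -- extremality then puts c in F.
  let g : ℝ → affineSpan ℝ F := fun t =>
    ⟨t • ((z' : E) - c) + z', AffineSubspace.vadd_mem_of_mem_direction
      (Submodule.smul_mem _ t hdir) z'.2⟩
  have hg : Continuous g := by
    refine Continuous.subtype_mk ?_ _
    fun_prop
  have hg0 : g 0 = z' := by
    ext
    simp [g]
  have hev : ∀ᶠ t in nhdsWithin (0 : ℝ) (Set.Ioi 0), g t ∈ ((↑) ⁻¹' F : Set (affineSpan ℝ F)) := by
    refine nhdsWithin_le_nhds (hg.continuousAt.eventually_mem ?_)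
    rw [hg0]
    exact mem_interior_iff_mem_nhds.1 hz'
  obtain ⟨t, ht, ht0⟩ := (hev.and self_mem_nhdsWithin).exists
  have ht0 : (0 : ℝ) < t := ht0
  refine hF.left_mem_of_mem_openSegment hc (hF.subset ht) hzF
    ⟨t / (1 + t), 1 / (1 + t), by positivity, by positivity, by field_simp; ring, ?_⟩
  simp only [g, smul_add, smul_sub, smul_smul]
  rw [show 1 / (1 + t) * t = t / (1 + t) by ring]
  have : (z' : E) = (t / (1 + t)) • (z' : E) + (1 / (1 + t)) • (z' : E) := by
    rw [← add_smul, show t / (1 + t) + 1 / (1 + t) = 1 by field_simp; ring, one_smul]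
  conv_rhs => rw [this]
  abel

/-! ### Symmetric tensors and their powers -/

namespace SymDensity

section Symmetric

variable {ι : Type} [Fintype ι] [DecidableEq ι] {n : ℕ}

/-- The exponent vector of an index: the number of modes carrying each value. -/
noncomputable def exponent (i : ι → Fin n) : Fin n →₀ ℕ := ∑ k, Finsupp.single (i k) 1

theorem exponent_apply (i : ι → Fin n) (a : Fin n) :
    exponent i a = Fintype.card {k // i k = a} := by
  rw [exponent, Finsupp.finsetSum_apply, Fintype.card_subtype, Finset.card_filter]
  exact Finset.sum_congr rfl fun k _ => by rw [Finsupp.single_apply]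

theorem exponent_comp (ω : Equiv.Perm ι) (i : ι → Fin n) : exponent (i ∘ ω) = exponent i :=
  Equiv.sum_comp ω fun k => Finsupp.single (i k) 1

/-- The fibres of i and j over each value have equal size; bijections between them glue to a
permutation. -/
theorem exists_perm_of_exponent_eq {i j : ι → Fin n} (h : exponent i = exponent j) :
    ∃ ω : Equiv.Perm ι, j ∘ ω = i := by
  have : ∀ a, Nonempty ({k // i k = a} ≃ {k // j k = a}) := fun a =>
    Fintype.card_eq.1 (by rw [← exponent_apply, ← exponent_apply, h])
  exact ⟨Equiv.ofFiberEquiv fun a => (this a).some, funext fun k => Equiv.ofFiberEquiv_map _ k⟩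

theorem exists_exponent_eq {s : Fin n →₀ ℕ} (hs : ∑ a, s a = Fintype.card ι) :
    ∃ i : ι → Fin n, exponent i = s := by
  obtain ⟨e⟩ : Nonempty (ι ≃ Σ a : Fin n, Fin (s a)) := Fintype.card_eq.1 (by simp [hs])
  refine ⟨fun k => (e k).1, Finsupp.ext fun a => ?_⟩
  rw [exponent_apply, ← Fintype.card_fin (s a)]
  refine Fintype.card_congr ((e.subtypeEquiv fun k => Iff.rfl).trans
    (Equiv.sigmaSubtype a))

theorem sum_exponent (i : ι → Fin n) : ∑ a, exponent i a = Fintype.card ι := by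
  have : ∀ a, exponent i a = ∑ k, Finsupp.single (i k) 1 a := fun a => by
    rw [exponent, Finsupp.finsetSum_apply]
  simp only [this]
  rw [Finset.sum_comm]
  simp [Finsupp.single_apply]

theorem apply_eq_of_exponent_eq {X : Tensor ℝ ι n} (hX : X ∈ symTensors ℝ ι n)
    {i j : ι → Fin n} (h : exponent i = exponent j) : X i = X j := by
  obtain ⟨ω, rfl⟩ := exists_perm_of_exponent_eq h
  exact hX ω j

theorem finrank_symTensors :
    Module.finrank ℝ (symTensors ℝ ι n) =
      (n + Fintype.card ι - 1).choose (Fintype.card ι) := by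
  let A := Finset.finsuppAntidiag (Finset.univ : Finset (Fin n)) (Fintype.card ι)
  have hA : ∀ s : Fin n →₀ ℕ, s ∈ A ↔ ∑ a, s a = Fintype.card ι := by
    intro s
    simp [A, Finset.mem_finsuppAntidiag]
  -- A symmetric tensor is a free choice of one entry per exponent vector of total degree the number
  -- of modes.
  let L : (A → ℝ) →ₗ[ℝ] Tensor ℝ ι n :=
    { toFun := fun f => WithLp.toLp 2 fun i => f ⟨exponent i, (hA _).2 (sum_exponent i)⟩
      map_add' := fun _ _ => rfl
      map_smul' := fun _ _ => rfl }
  have hL : ∀ f i, L f i = f ⟨exponent i, (hA _).2 (sum_exponent i)⟩ := fun _ _ => rfl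
  have hrep : ∀ s : A, ∃ i : ι → Fin n, exponent i = s.1 := fun s =>
    exists_exponent_eq ((hA _).1 s.2)
  choose rep hrep using hrep
  have hinj : Function.Injective L := by
    intro f g h
    funext s
    have := congrArg (fun X : Tensor ℝ ι n => X (rep s)) h
    simpa only [hL, hrep] using this
  have hrange : LinearMap.range L = symTensors ℝ ι n := by
    ext X
    constructor
    · rintro ⟨f, rfl⟩ ω i
      simp only [hL, exponent_comp]
    · intro hX
      refine ⟨fun s => X (rep s), ?_⟩
      ext i
      exact apply_eq_of_exponent_eq hX (hrep _)
  rw [← hrange, LinearMap.finrank_range_of_inj hinj, Module.finrank_fintype_fun_eq_card,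
    Fintype.card_coe, Finset.card_finsuppAntidiag_nat_eq_choose, Finset.card_univ, Fintype.card_fin]

/-- A symmetric tensor orthogonal to all powers of unit vectors vanishes. -/
theorem eq_zero_of_inner_power_eq_zero [Nonempty ι] {X : Tensor ℝ ι n}
    (hX : X ∈ symTensors ℝ ι n)
    (h : ∀ x : EuclideanSpace ℝ (Fin n), ‖x‖ = 1 → inner ℝ (outer fun _ : ι => x) X = 0) :
    X = 0 := by
  have h' : ∀ x : EuclideanSpace ℝ (Fin n), inner ℝ (outer fun _ : ι => x) X = 0 := by
    intro x
    by_cases hx : x = 0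
    · have : outer (fun _ : ι => x) = 0 := by
        ext i
        simp [hx]
      rw [this, inner_zero_left]
    · have h1 := h (‖x‖⁻¹ • x) (by rw [norm_smul]; simp [hx])
      rw [outer_smul (fun _ => ‖x‖⁻¹) fun _ => x, inner_smul_left] at h1
      simpa [hx] using h1
  -- The pairing with powers is a polynomial in x that vanishes at every real point, hence
  -- identically.
  have hp : ∑ i, MvPolynomial.monomial (exponent i) (X i) = 0 := by
    refine MvPolynomial.funext fun x => ?_
    have := h' (WithLp.toLp 2 x)
    simp only [PiLp.inner_apply, outer_apply, RCLike.inner_apply, conj_trivial] at this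
    rw [map_zero, map_sum, ← this]
    refine Finset.sum_congr rfl fun i _ => ?_
    rw [← mul_one (X i), ← MvPolynomial.C_mul_monomial, exponent, MvPolynomial.monomial_sum_one]
    simp [← MvPolynomial.X.eq_def]
  ext j
  -- This coefficient is X j times the number of indices with the exponent vector of j, which is
  -- positive.
  have hc := congrArg (MvPolynomial.coeff (exponent j)) hp
  simp only [MvPolynomial.coeff_sum, MvPolynomial.coeff_monomial, MvPolynomial.coeff_zero] at hc
  rw [← Finset.sum_filter, Finset.sum_congr rfl (g := fun _ => X j) fun i hi =>
    apply_eq_of_exponent_eq hX (Finset.mem_filter.1 hi).2, Finset.sum_const, nsmul_eq_mul] at hc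
  rcases mul_eq_zero.1 hc with h0 | h0
  · have : 0 < Finset.card {i : ι → Fin n | exponent i = exponent j} :=
      Finset.card_pos.2 ⟨j, Finset.mem_filter.2 ⟨Finset.mem_univ j, rfl⟩⟩
    simp only [Nat.cast_eq_zero] at h0
    exact absurd h0 this.ne'
  · exact h0

end Symmetric

section Power

variable {d n : ℕ}

theorem power_mem_symTensors (x : EuclideanSpace ℝ (Fin n)) :
    power d x ∈ symTensors ℝ (Modes d) n := by
  intro ω i
  simp only [power, outer_apply]
  exact Equiv.prod_comp ω fun k => x (i k)

/-- The powers of real unit vectors. -/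
def unitPowers (d n : ℕ) : Set (Tensor ℝ (Modes d) n) :=
  {T | ∃ x : EuclideanSpace ℝ (Fin n), ‖x‖ = 1 ∧ T = power d x}

theorem unitPowers_subset_productStates : unitPowers d n ⊆ productStates ℝ (Modes d) n := by
  rintro _ ⟨x, hx, rfl⟩
  exact ⟨fun _ => x, fun _ => hx, rfl⟩

theorem unitPowers_nonempty (hn : 0 < n) : (unitPowers d n).Nonempty :=
  ⟨_, EuclideanSpace.single ⟨0, hn⟩ 1, by simp, rfl⟩

theorem tensorTrace_power {x : EuclideanSpace ℝ (Fin n)} (hx : ‖x‖ = 1) :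
    tensorTrace (power d x) = 1 := by
  rw [← pairTrace_one, power, pairTrace_outer]
  refine Finset.prod_eq_one fun k _ => ?_
  have := EuclideanSpace.real_norm_sq_eq x
  rw [hx] at this
  simpa [sq] using this.symm

/-- The residual of the orthogonal projection onto the span is symmetric and orthogonal to all
powers, hence zero. -/
theorem span_unitPowers (hd : 0 < d) :
    Submodule.span ℝ (unitPowers d n) = symTensors ℝ (Modes d) n := by
  have : Nonempty (Modes d) := ⟨Sum.inl ⟨0, hd⟩⟩
  have hle : Submodule.span ℝ (unitPowers d n) ≤ symTensors ℝ (Modes d) n := by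
    rw [Submodule.span_le]
    rintro _ ⟨x, -, rfl⟩
    exact power_mem_symTensors x
  refine le_antisymm hle fun X hX => ?_
  set P := Submodule.span ℝ (unitPowers d n)
  have h0 : X - P.starProjection X = 0 := by
    refine eq_zero_of_inner_power_eq_zero (Submodule.sub_mem _ hX (hle (Submodule.starProjection_apply_mem P X))) ?_
    intro x hx
    exact Submodule.sub_starProjection_mem_orthogonal (K := P) X _
      (Submodule.subset_span ⟨x, hx, rfl⟩)
  rw [sub_eq_zero.1 h0]
  exact Submodule.starProjection_apply_mem P X

end Power

end SymDensity

/-! ### Density tensors and separability -/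

namespace SymDensity

section Density

variable {d n : ℕ}

theorem tensorTrace_complexify (R : Tensor ℝ (Modes d) n) :
    tensorTrace (complexify R) = ((tensorTrace R : ℝ) : ℂ) := by
  simp [tensorTrace, Matrix.trace, unfold, complexify]

theorem tensorTrace_of_mem_symDensityTensors {R : Tensor ℝ (Modes d) n}
    (hR : R ∈ symDensityTensors d n) : tensorTrace R = 1 := by
  have := hR.2.2
  rw [tensorTrace_complexify] at this
  exact_mod_cast this

theorem ne_zero_of_mem_symDensityTensors {R : Tensor ℝ (Modes d) n}
    (hR : R ∈ symDensityTensors d n) : R ≠ 0 := by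
  rintro rfl
  have h := tensorTrace_of_mem_symDensityTensors hR
  rw [← pairTrace_one, map_zero] at h
  exact zero_ne_one h

/-- Nonnegative 2×2 principal minors bound each squared entry by a product of diagonal entries;
these products sum to (tr R)² = 1. -/
theorem norm_le_one_of_mem_symDensityTensors {R : Tensor ℝ (Modes d) n}
    (hR : R ∈ symDensityTensors d n) : ‖R‖ ≤ 1 := by
  have hminor : ∀ i j : Fin d → Fin n,
      R (Sum.elim i j) ^ 2 ≤ R (Sum.elim i i) * R (Sum.elim j j) := by
    intro i j
    have hswap : R (Sum.elim j i) = R (Sum.elim i j) := by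
      rw [← hR.1 (Equiv.sumComm _ _) (Sum.elim i j)]
      exact congrArg R (funext fun k => by cases k <;> rfl)
    have h := (hR.2.1.submatrix ![i, j]).det_nonneg
    rw [Matrix.det_fin_two] at h
    simp only [unfold, complexify, Matrix.submatrix_apply, Matrix.cons_val_zero,
      Matrix.cons_val_one, hswap] at h
    norm_cast at h
    linarith [sq (R (Sum.elim i j))]
  have htr : ∑ i, R (Sum.elim i i) = 1 := tensorTrace_of_mem_symDensityTensors hR
  rw [← sq_le_one_iff₀ (norm_nonneg R), EuclideanSpace.real_norm_sq_eq,
    ← (Equiv.sumArrowEquivProdArrow (Fin d) (Fin d) (Fin n)).symm.sum_comp, Fintype.sum_prod_type]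
  calc ∑ i, ∑ j, R (Sum.elim i j) ^ 2
      ≤ ∑ i, ∑ j, R (Sum.elim i i) * R (Sum.elim j j) :=
        Finset.sum_le_sum fun i _ => Finset.sum_le_sum fun j _ => hminor i j
    _ = 1 := by simp only [← Finset.mul_sum, htr, mul_one]

theorem convex_symDensityTensors : Convex ℝ (symDensityTensors d n) := by
  intro R hR S hS a b ha hb hab
  refine ⟨(symTensors ℝ (Modes d) n).convex hR.1 hS.1 ha hb hab, ?_, ?_⟩
  · have : unfold (complexify (a • R + b • S)) =
        (a : ℂ) • unfold (complexify R) + (b : ℂ) • unfold (complexify S) := by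
      ext i j
      simp [unfold, complexify]
    rw [this]
    exact (hR.2.1.smul (by exact_mod_cast ha)).add (hS.2.1.smul (by exact_mod_cast hb))
  · rw [tensorTrace_complexify, ← pairTrace_one, map_add, map_smul, map_smul, pairTrace_one,
      pairTrace_one, tensorTrace_of_mem_symDensityTensors hR,
      tensorTrace_of_mem_symDensityTensors hS]
    simp [hab]

theorem power_mem_symDensityTensors {x : EuclideanSpace ℝ (Fin n)} (hx : ‖x‖ = 1) :
    power d x ∈ symDensityTensors d n := by
  refine ⟨power_mem_symTensors x, ?_, ?_⟩
  · have : unfold (complexify (power d x)) =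
        Matrix.vecMulVec (fun i : Fin d → Fin n => ∏ k, (x (i k) : ℂ))
          (star fun i : Fin d → Fin n => ∏ k, (x (i k) : ℂ)) := by
      ext i j
      simp [unfold, complexify, power, Matrix.vecMulVec_apply, Fintype.prod_sum_type]
    rw [this]
    exact Matrix.posSemidef_vecMulVec_self_star _
  · rw [tensorTrace_complexify, tensorTrace_power hx, Complex.ofReal_one]

theorem convexHull_unitPowers_subset :
    convexHull ℝ (unitPowers d n) ⊆ symDensityTensors d n := by
  refine convexHull_min ?_ convex_symDensityTensors
  rintro _ ⟨x, hx, rfl⟩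
  exact power_mem_symDensityTensors hx

theorem stronglySeparable_eq : stronglySeparable d n = convexHull ℝ (unitPowers d n) :=
  Set.Subset.antisymm (fun _ h => h.2) fun _ h => ⟨convexHull_unitPowers_subset h, h⟩

theorem unitPowers_eq_image (𝕜 : Type) [RCLike 𝕜] :
    {T | ∃ x : EuclideanSpace ℝ (Fin n), ‖x‖ = 1 ∧ T = castTensor 𝕜 (power d x)} =
      castTensor 𝕜 '' unitPowers d n := by
  ext T
  constructor
  · rintro ⟨x, hx, rfl⟩
    exact ⟨_, ⟨x, hx, rfl⟩, rfl⟩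
  · rintro ⟨_, ⟨x, hx, rfl⟩, rfl⟩
    exact ⟨x, hx, rfl⟩

/-- A real symmetric tensor of trace one that is, over `ℝ` or `ℂ`, in the convex hull of the
product states is a convex combination of powers of real unit vectors. -/
theorem mem_convexHull_unitPowers (𝕜 : Type) [RCLike 𝕜] (hd : 2 ≤ d) {R : Tensor ℝ (Modes d) n}
    (hR : R ∈ symTensors ℝ (Modes d) n) (htr : tensorTrace R = 1)
    (h : castTensor 𝕜 R ∈ convexHull ℝ (productStates 𝕜 (Modes d) n)) :
    R ∈ convexHull ℝ (unitPowers d n) := by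
  have htr' : tensorTrace (castTensor 𝕜 R) = 1 := by
    have : tensorTrace (castTensor 𝕜 R) = ((tensorTrace R : ℝ) : 𝕜) := by
      simp [tensorTrace, Matrix.trace, unfold]
    rw [this, htr, RCLike.ofReal_one]
  have := mem_convexHull_power_of_mem_convexHull_productStates hd
    (castTensor_mem_symTensors (𝕜 := 𝕜) hR) htr' h
  rw [unitPowers_eq_image, ← LinearMap.image_convexHull] at this
  obtain ⟨S, hS, hSR⟩ := this
  rwa [← castTensor_injective hSR]

/-- Separable tensors thereby lie in the hull of the complex product states of order 2d. -/
theorem pureDensity_outer (x : Fin d → EuclideanSpace ℂ (Fin n)) :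
    pureDensity (outer x) = outer (Sum.elim x fun k => conjVec (x k)) := by
  ext i
  simp [pureDensity, Fintype.prod_sum_type]

theorem mem_stronglySeparable_of_complexify_mem_separable (hd : 2 ≤ d)
    {R : Tensor ℝ (Modes d) n} (hR : R ∈ symDensityTensors d n)
    (h : complexify R ∈ separable d n) : R ∈ stronglySeparable d n := by
  refine ⟨hR, mem_convexHull_unitPowers ℂ hd hR.1 (tensorTrace_of_mem_symDensityTensors hR) ?_⟩
  refine convexHull_mono ?_ h
  rintro _ ⟨_, ⟨x, hx, rfl⟩, rfl⟩
  refine ⟨_, ?_, pureDensity_outer x⟩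
  rintro (k | k) <;> simp [hx]

theorem complexify_mem_separable {R : Tensor ℝ (Modes d) n} (hR : R ∈ stronglySeparable d n) :
    complexify R ∈ separable d n := by
  have h : castTensor ℂ R ∈ castTensor ℂ '' convexHull ℝ (unitPowers d n) := ⟨R, hR.2, rfl⟩
  rw [LinearMap.image_convexHull] at h
  refine convexHull_mono ?_ h
  rintro _ ⟨_, ⟨x, hx, rfl⟩, rfl⟩
  refine ⟨outer fun _ => WithLp.toLp 2 fun a => (x a : ℂ), ⟨_, fun _ => ?_, rfl⟩, ?_⟩
  · rw [← hx, EuclideanSpace.norm_eq, EuclideanSpace.norm_eq]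
    simp
  · ext i
    simp [power, pureDensity, Fintype.prod_sum_type]

theorem tensorTrace_le_nucNorm (hd : 0 < d) (B : Tensor ℝ (Modes d) n) :
    tensorTrace B ≤ nucNorm B := by
  have : Nonempty (Modes d) := ⟨Sum.inl ⟨0, hd⟩⟩
  rw [← pairTrace_one]
  exact le_nucNorm_of_le (pairTrace 1)
    (fun y => (Real.le_norm_self _).trans (norm_pairTrace_outer_le 1 y)) B

theorem mem_nucBall_of_mem_stronglySeparable (hd : 0 < d) (hn : 0 < n)
    {B : Tensor ℝ (Modes d) n} (hB : B ∈ stronglySeparable d n) : B ∈ nucBall d n := by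
  have : Nonempty (Modes d) := ⟨Sum.inl ⟨0, hd⟩⟩
  exact ⟨hB.1.1, (nucNorm_le_one_iff hn).2 (convexHull_mono unitPowers_subset_productStates hB.2)⟩

theorem tensorTrace_eq_one_iff (hd : 2 ≤ d) (hn : 0 < n) {B : Tensor ℝ (Modes d) n}
    (hB : B ∈ nucBall d n) : tensorTrace B = 1 ↔ B ∈ stronglySeparable d n := by
  have : Nonempty (Modes d) := ⟨Sum.inl ⟨0, by omega⟩⟩
  refine ⟨fun h => ?_, fun h => tensorTrace_of_mem_symDensityTensors h.1⟩
  rw [stronglySeparable_eq]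
  refine mem_convexHull_unitPowers ℝ hd hB.1 h ?_
  rw [castTensor_real]
  exact (nucNorm_le_one_iff hn).1 hB.2

theorem specNorm_eq_one_iff (hd : 2 ≤ d) (hn : 0 < n) {R : Tensor ℝ (Modes d) n}
    (hR : R ∈ symDensityTensors d n) :
    specNorm R = 1 ↔ ∃ x : EuclideanSpace ℝ (Fin n), ‖x‖ = 1 ∧ R = power d x := by
  have : Nonempty (Modes d) := ⟨Sum.inl ⟨0, by omega⟩⟩
  constructor
  · intro h
    -- R is itself a product state, and symmetry makes all its pairings equal to its trace 1.
    obtain ⟨y, hy, rfl⟩ := mem_productStates_of_specNorm_eq_one hn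
      (norm_le_one_of_mem_symDensityTensors hR) h
    obtain ⟨x, hx, hyx⟩ := exists_power_of_pairTrace_eq_one hd hy fun ω => by
      rw [pairTrace_of_mem_symTensors hR.1, tensorTrace_of_mem_symDensityTensors hR]
    exact ⟨x, hx, by rw [hyx, castTensor_real]⟩
  · rintro ⟨x, hx, rfl⟩
    refine le_antisymm
      ((specNorm_le_norm hn _).trans (norm_le_one_of_mem_symDensityTensors hR)) ?_
    have h1 := norm_eq_one_of_mem_productStates
      (unitPowers_subset_productStates (d := d) ⟨x, hx, rfl⟩)
    have := le_specNorm (power d x) (unitPowers_subset_productStates ⟨x, hx, rfl⟩)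
    rwa [real_inner_self_eq_norm_sq, h1, one_pow, norm_one] at this

end Density

/-! ### The face of strongly separable tensors -/

section Face

variable {d n : ℕ}

/-- The trace is at most 1 on the ball, with equality exactly on this set; a convex combination of
positive weights reaches 1 only if both endpoints do. -/
theorem isFace_stronglySeparable (hd : 2 ≤ d) (hn : 0 < n) :
    IsFace (nucBall d n) (stronglySeparable d n) := by
  have hd0 : 0 < d := by omega
  refine ⟨stronglySeparable_eq (d := d) (n := n) ▸ convex_convexHull _ _,
    fun B hB => mem_nucBall_of_mem_stronglySeparable hd0 hn hB, ?_⟩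
  rintro x hx y hy z hz ⟨a, b, ha, hb, hab, rfl⟩
  rw [← tensorTrace_eq_one_iff hd hn hx]
  have hz := tensorTrace_of_mem_symDensityTensors hz.1
  rw [← pairTrace_one, map_add, map_smul, map_smul, pairTrace_one, pairTrace_one, smul_eq_mul,
    smul_eq_mul] at hz
  have h1 := (tensorTrace_le_nucNorm hd0 x).trans hx.2
  have h2 := (tensorTrace_le_nucNorm hd0 y).trans hy.2
  refine le_antisymm h1 ?_
  by_contra! hlt
  nlinarith [mul_lt_mul_of_pos_left hlt ha, mul_le_mul_of_nonneg_left h2 hb.le]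

theorem stronglySeparable_ne_nucBall (hd : 0 < d) :
    stronglySeparable d n ≠ nucBall d n := by
  have : Nonempty (Modes d) := ⟨Sum.inl ⟨0, hd⟩⟩
  intro h
  have h0 : (0 : Tensor ℝ (Modes d) n) ∈ nucBall d n :=
    ⟨Submodule.zero_mem _, (nucNorm_le_sum_abs _).trans (by simp)⟩
  rw [← h] at h0
  exact ne_zero_of_mem_symDensityTensors h0.1 rfl

theorem vectorSpan_convexHull {E : Type*} [AddCommGroup E] [Module ℝ E] (s : Set E) :
    vectorSpan ℝ (convexHull ℝ s) = vectorSpan ℝ s := by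
  rw [← direction_affineSpan, affineSpan_convexHull, direction_affineSpan]

theorem finrank_vectorSpan_unitPowers (hd : 0 < d) (hn : 0 < n) :
    Module.finrank ℝ (vectorSpan ℝ (unitPowers d n)) + 1 = (n + 2 * d - 1).choose (2 * d) := by
  rw [← finrank_span_eq_finrank_vectorSpan_add_one (unitPowers_nonempty hn) (pairTrace 1),
    span_unitPowers hd, finrank_symTensors]
  · simp [two_mul]
  · rintro _ ⟨x, hx, rfl⟩
    exact tensorTrace_power hx

theorem affDim_stronglySeparable (hd : 0 < d) (hn : 0 < n) :
    affDim (stronglySeparable d n) = (n + 2 * d - 1).choose (2 * d) - 1 := by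
  rw [← finrank_vectorSpan_unitPowers hd hn, affDim, stronglySeparable_eq, vectorSpan_convexHull,
    Nat.add_sub_cancel]

theorem affDim_le_of_isFace (hd : 0 < d) (hn : 0 < n) {F : Set (Tensor ℝ (Modes d) n)}
    (hF : IsFace (nucBall d n) F) (hne : F ≠ nucBall d n) :
    affDim F ≤ affDim (stronglySeparable d n) := by
  rcases F.eq_empty_or_nonempty with rfl | hF0
  · rw [affDim, vectorSpan_empty, finrank_bot]
    exact Nat.zero_le _
  have hle : vectorSpan ℝ F ≤ symTensors ℝ (Modes d) n := by
    rw [vectorSpan_def, Submodule.span_le]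
    rintro _ ⟨x, hx, y, hy, rfl⟩
    exact Submodule.sub_mem _ (hF.2.subset hx).1 (hF.2.subset hy).1
  -- Were the directions of F all symmetric tensors, F would be the whole ball.
  have hlt : vectorSpan ℝ F ≠ symTensors ℝ (Modes d) n := fun h =>
    hne (hF.2.eq_of_le_vectorSpan hF.1 hF0 fun B hB => h ▸ hB.1)
  have h1 := Submodule.finrank_lt_finrank_of_lt (lt_of_le_of_ne hle hlt)
  rw [finrank_symTensors] at h1
  rw [affDim_stronglySeparable hd hn, affDim]
  rw [show Fintype.card (Modes d) = 2 * d by simp [two_mul]] at h1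
  omega

/-- Carathéodory inside the hyperplane tr = 1, which saves one term over the bound in the full
symmetric space. -/
theorem exists_sum_power_of_mem_stronglySeparable (hd : 0 < d) (hn : 0 < n)
    {R : Tensor ℝ (Modes d) n} (hR : R ∈ stronglySeparable d n) :
    ∃ r : ℕ, r ≤ (n + 2 * d - 1).choose (2 * d) ∧
      ∃ (a : Fin r → ℝ) (x : Fin r → EuclideanSpace ℝ (Fin n)),
        (∀ k, 0 ≤ a k) ∧ ∑ k, a k = 1 ∧ (∀ k, ‖x k‖ = 1) ∧ R = ∑ k, a k • power d (x k) := by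
  obtain ⟨κ, _, z, w, hz, hind, hw, hw1, hsum⟩ := eq_pos_convex_span_of_mem_convexHull hR.2
  have hz : ∀ k, ∃ x : EuclideanSpace ℝ (Fin n), ‖x‖ = 1 ∧ z k = power d x := fun k => hz ⟨k, rfl⟩
  choose x hx hzx using hz
  let e := (Fintype.equivFin κ).symm
  refine ⟨Fintype.card κ, ?_, w ∘ e, x ∘ e, fun k => (hw _).le, ?_, fun k => hx _, ?_⟩
  · rw [← finrank_vectorSpan_unitPowers hd hn]
    refine hind.card_le_finrank_succ.trans (Nat.succ_le_succ
      (Submodule.finrank_mono (vectorSpan_mono ℝ ?_)))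
    rintro _ ⟨k, rfl⟩
    exact ⟨x k, hx k, hzx k⟩
  · rw [← hw1]
    exact Equiv.sum_comp e w
  · rw [← hsum, ← Equiv.sum_comp e]
    simp [hzx]

end Face

end SymDensity

/-! ### Gaussian integrals and polar coordinates -/

/-- The arithmetic-geometric mean inequality for a product of nonnegative factors. -/
theorem Finset.prod_le_sum_pow_card_div {ι : Type*} [Fintype ι] [Nonempty ι] (a : ι → ℝ)
    (ha : ∀ k, 0 ≤ a k) :
    ∏ k, a k ≤ ∑ k, (Fintype.card ι : ℝ)⁻¹ * a k ^ Fintype.card ι := by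
  have h := Real.geom_mean_le_arith_mean_weighted Finset.univ
    (fun _ : ι => (Fintype.card ι : ℝ)⁻¹) (fun k => a k ^ Fintype.card ι)
    (fun _ _ => by positivity) (by simp) fun k _ => pow_nonneg (ha k) _
  simpa only [Real.pow_rpow_inv_natCast (ha _) Fintype.card_ne_zero] using h

theorem Real.Gamma_add_natCast {s : ℝ} (hs : 0 < s) (d : ℕ) :
    Real.Gamma (s + d) = (∏ k ∈ Finset.range d, (s + k)) * Real.Gamma s := by
  induction d with
  | zero => simp
  | succ d ih =>
    rw [Nat.cast_succ, ← add_assoc, Real.Gamma_add_one (by positivity), ih,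
      Finset.prod_range_succ]
    ring

theorem integral_pow_mul_exp_neg_sq_Ioi (m : ℕ) :
    ∫ t in Set.Ioi (0 : ℝ), t ^ m * Real.exp (-t ^ 2) = 1 / 2 * Real.Gamma ((m + 1) / 2) := by
  rw [← integral_rpow_mul_exp_neg_rpow (p := 2) (q := m) two_pos
    (by have : (0 : ℝ) ≤ m := m.cast_nonneg; linarith)]
  simp only [Real.rpow_natCast, Real.rpow_two]

theorem integral_pow_mul_exp_neg_sq (d : ℕ) :
    ∫ t : ℝ, t ^ (2 * d) * Real.exp (-t ^ 2) = Real.Gamma (1 / 2 + d) := by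
  have h := integral_comp_abs (f := fun t : ℝ => t ^ (2 * d) * Real.exp (-t ^ 2))
  simp only [pow_mul, sq_abs] at h
  simp only [← pow_mul] at h
  rw [h, integral_pow_mul_exp_neg_sq_Ioi,
    show ((2 * d : ℕ) + 1 : ℝ) / 2 = 1 / 2 + d by push_cast; ring]
  ring

/-- The Gaussian moment of a linear form of norm one. -/
theorem integral_inner_pow_mul_exp_neg_norm_sq {n : ℕ} (d : ℕ) {x : EuclideanSpace ℝ (Fin n)}
    (hx : ‖x‖ = 1) :
    ∫ z : EuclideanSpace ℝ (Fin n), inner ℝ x z ^ (2 * d) * Real.exp (-‖z‖ ^ 2) =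
      Real.Gamma (1 / 2 + d) * Real.Gamma (1 / 2) ^ (n - 1) := by
  have hn : 0 < n := by
    rcases Nat.eq_zero_or_pos n with rfl | h
    · simp [Subsingleton.elim x 0] at hx
    · exact h
  let i₀ : Fin n := ⟨0, hn⟩
  -- In an orthonormal basis starting with x the linear form is a coordinate, and the integral
  -- factors.
  obtain ⟨b, hb⟩ := Orthonormal.exists_orthonormalBasis_extension_of_card_eq (𝕜 := ℝ)
    (E := EuclideanSpace ℝ (Fin n)) (ι := Fin n) (by simp) (v := fun _ => x) (s := {i₀}) (by
      rw [orthonormal_iff_ite]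
      rintro ⟨i, rfl⟩ ⟨j, rfl⟩
      simp [hx])
  have hb0 : b i₀ = x := hb i₀ rfl
  have h1 := b.repr.measurePreserving.integral_comp b.repr.toHomeomorph.measurableEmbedding
    (fun w : EuclideanSpace ℝ (Fin n) => w i₀ ^ (2 * d) * Real.exp (-‖w‖ ^ 2))
  have h2 : ∀ z, b.repr z i₀ = inner ℝ x z := fun z => by rw [b.repr_apply_apply, hb0]
  simp only [h2, LinearIsometryEquiv.norm_map] at h1
  rw [h1, ← (EuclideanSpace.volume_preserving_symm_measurableEquiv_toLp (Fin n)).symm.integral_comp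
    (MeasurableEquiv.measurableEmbedding _)]
  -- The exponent `2 * 0` lets the remaining coordinates use the same one-dimensional formula.
  have h3 : ∀ w : Fin n → ℝ, w i₀ ^ (2 * d) * Real.exp (-‖WithLp.toLp 2 w‖ ^ 2) =
      ∏ i, w i ^ (if i = i₀ then 2 * d else 2 * 0) * Real.exp (-w i ^ 2) := by
    intro w
    rw [Finset.prod_mul_distrib, ← Real.exp_sum, EuclideanSpace.real_norm_sq_eq,
      Finset.sum_neg_distrib, Finset.prod_eq_single i₀]
    · simp
    · intro i _ hi
      simp [hi]
    · simp
  refine (integral_congr_ae (Filter.Eventually.of_forall h3)).trans ?_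
  rw [integral_fintype_prod_volume_eq_prod
    fun i (t : ℝ) => t ^ (if i = i₀ then 2 * d else 2 * 0) * Real.exp (-t ^ 2)]
  rw [← Finset.mul_prod_erase _ _ (Finset.mem_univ i₀), if_pos rfl, integral_pow_mul_exp_neg_sq,
    Finset.prod_congr rfl (g := fun _ => Real.Gamma (1 / 2)) fun i hi => by
      rw [if_neg (Finset.ne_of_mem_erase hi), integral_pow_mul_exp_neg_sq, Nat.cast_zero, add_zero]]
  rw [Finset.prod_const, Finset.card_erase_of_mem (Finset.mem_univ _), Finset.card_univ,
    Fintype.card_fin]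

/-- Polar coordinates for the product of a power of a linear form and a Gaussian. -/
theorem integral_inner_pow_mul_exp_eq_sphere {n : ℕ} (hn : 0 < n) (m : ℕ)
    (x : EuclideanSpace ℝ (Fin n)) :
    ∫ z : EuclideanSpace ℝ (Fin n), inner ℝ x z ^ m * Real.exp (-‖z‖ ^ 2) =
      (∫ y : Metric.sphere (0 : EuclideanSpace ℝ (Fin n)) 1, inner ℝ x y.1 ^ m
        ∂(volume : Measure (EuclideanSpace ℝ (Fin n))).toSphere) *
        (1 / 2 * Real.Gamma ((n + m) / 2)) := by
  have : Nonempty (Fin n) := ⟨⟨0, hn⟩⟩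
  let E := EuclideanSpace ℝ (Fin n)
  let μ : Measure E := volume
  have hdim : Module.finrank ℝ E = n := by simp [E]
  calc ∫ z : E, inner ℝ x z ^ m * Real.exp (-‖z‖ ^ 2)
      = ∫ z : ({(0)}ᶜ : Set E), inner ℝ x z.1 ^ m * Real.exp (-‖z.1‖ ^ 2) ∂(μ.comap (↑)) := by
        rw [integral_subtype_comap (measurableSet_singleton _).compl
          fun z => inner ℝ x z ^ m * Real.exp (-‖z‖ ^ 2), restrict_compl_singleton]
    _ = ∫ p : Metric.sphere (0 : E) 1 × Set.Ioi (0 : ℝ),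
          inner ℝ x p.1.1 ^ m * (p.2.1 ^ m * Real.exp (-p.2.1 ^ 2))
          ∂μ.toSphere.prod (.volumeIoiPow (Module.finrank ℝ E - 1)) := by
        rw [← μ.measurePreserving_homeomorphUnitSphereProd.integral_comp
          (Homeomorph.measurableEmbedding _)]
        -- Homogeneity: the form at z is ‖z‖ times its value at z/‖z‖.
        refine integral_congr_ae (Filter.Eventually.of_forall fun z => ?_)
        have hz : (0 : ℝ) < ‖z.1‖ := norm_pos_iff.2 z.2
        simp only [homeomorphUnitSphereProd_apply_fst_coe, homeomorphUnitSphereProd_apply_snd_coe,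
          inner_smul_right, mul_pow, inv_pow]
        field_simp
    _ = (∫ y : Metric.sphere (0 : E) 1, inner ℝ x y.1 ^ m ∂μ.toSphere) *
          ∫ r : Set.Ioi (0 : ℝ), r.1 ^ m * Real.exp (-r.1 ^ 2)
            ∂(.volumeIoiPow (Module.finrank ℝ E - 1)) :=
        integral_prod_mul (fun y : Metric.sphere (0 : E) 1 => inner ℝ x y.1 ^ m)
          fun r : Set.Ioi (0 : ℝ) => r.1 ^ m * Real.exp (-r.1 ^ 2)
    _ = _ := by
        congr 1
        simp only [Measure.volumeIoiPow, ENNReal.ofReal]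
        rw [integral_withDensity_eq_integral_smul
            (measurable_subtype_coe.pow_const _).real_toNNReal,
          integral_subtype_comap measurableSet_Ioi fun r : ℝ =>
            Real.toNNReal (r ^ (Module.finrank ℝ E - 1)) • (r ^ m * Real.exp (-r ^ 2)),
          setIntegral_congr_fun (g := fun r => r ^ (n - 1 + m) * Real.exp (-r ^ 2))
            measurableSet_Ioi fun r hr => ?_]
        · rw [integral_pow_mul_exp_neg_sq_Ioi]
          congr 3
          push_cast [Nat.cast_pred hn]
          ring
        · rw [NNReal.smul_def, Real.coe_toNNReal _ (pow_nonneg (le_of_lt hr) _), hdim, smul_eq_mul]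
          ring

/-! ### The sphere average and the lower bound -/

namespace SymDensity

variable {d n : ℕ}

theorem isProbabilityMeasure_sphereMeasure (hn : 0 < n) :
    IsProbabilityMeasure (sphereMeasure n) := by
  have : Nonempty (Fin n) := ⟨⟨0, hn⟩⟩
  refine ⟨?_⟩
  rw [sphereMeasure, Measure.smul_apply, smul_eq_mul]
  exact ENNReal.inv_mul_cancel (Measure.measure_univ_ne_zero.2 (Measure.toSphere_ne_zero _))
    (measure_ne_top _ _)

theorem isOpenPosMeasure_sphereMeasure : (sphereMeasure n).IsOpenPosMeasure :=
  Measure.isOpenPosMeasure_smul _ (ENNReal.inv_ne_zero.2 (measure_ne_top _ _))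

/-- The moment of order `2d` of a coordinate on the unit sphere of `ℝⁿ`. -/
noncomputable def sphereMoment (d n : ℕ) : ℝ :=
  (∏ k ∈ Finset.range d, ((1 : ℝ) / 2 + k)) / (∏ k ∈ Finset.range d, ((n : ℝ) / 2 + k))

theorem integral_inner_pow_sphereMeasure (hn : 0 < n) (d : ℕ) {x : EuclideanSpace ℝ (Fin n)}
    (hx : ‖x‖ = 1) :
    ∫ y, inner ℝ x y.1 ^ (2 * d) ∂(sphereMeasure n) = sphereMoment d n := by
  have : Nonempty (Fin n) := ⟨⟨0, hn⟩⟩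
  have hn2 : (0 : ℝ) < n / 2 := by positivity
  have h1 := integral_inner_pow_mul_exp_eq_sphere hn (2 * d) x
  -- Comparison with the moment of order zero eliminates the sphere's area and the common Gamma
  -- factors.
  have h0 := integral_inner_pow_mul_exp_eq_sphere hn (2 * 0) x
  rw [integral_inner_pow_mul_exp_neg_norm_sq _ hx] at h1 h0
  rw [show ((n : ℝ) + (2 * d : ℕ)) / 2 = n / 2 + d by push_cast; ring,
    Real.Gamma_add_natCast hn2, Real.Gamma_add_natCast one_half_pos] at h1
  simp only [Nat.cast_zero, mul_zero, add_zero, pow_zero, integral_const, smul_eq_mul,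
    mul_one] at h0
  rw [sphereMeasure, integral_smul_measure, ENNReal.toReal_inv, smul_eq_mul, sphereMoment]
  set S := ((volume : Measure (EuclideanSpace ℝ (Fin n))).toSphere Set.univ).toReal
  have hS : 0 < S := ENNReal.toReal_pos
    (Measure.measure_univ_ne_zero.2 (Measure.toSphere_ne_zero _)) (measure_ne_top _ _)
  have hP : 0 < ∏ k ∈ Finset.range d, ((n : ℝ) / 2 + k) :=
    Finset.prod_pos fun k _ => by positivity
  have hG := Real.Gamma_pos_of_pos hn2
  change _ = S * _ at h0
  rw [mul_assoc, h0] at h1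
  rw [eq_div_iff hP.ne', inv_mul_eq_div, div_mul_eq_mul_div, div_eq_iff hS.ne']
  have : (0 : ℝ) < 1 / 2 * Real.Gamma (n / 2) := by positivity
  apply mul_right_cancel₀ this.ne'
  linear_combination -h1

theorem continuous_power : Continuous (power d : EuclideanSpace ℝ (Fin n) → _) :=
  continuous_outer.comp (continuous_pi fun _ => continuous_id)

theorem integrable_sphereMeasure (hn : 0 < n) {F : Type*} [NormedAddCommGroup F]
    {f : Metric.sphere (0 : EuclideanSpace ℝ (Fin n)) 1 → F} (hf : Continuous f) :
    Integrable f (sphereMeasure n) := by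
  have := isProbabilityMeasure_sphereMeasure hn
  exact hf.integrable_of_hasCompactSupport (HasCompactSupport.of_compactSpace f)

theorem inner_sphereAverage (hn : 0 < n) (X : Tensor ℝ (Modes d) n) :
    inner ℝ X (sphereAverage d n) = ∫ y, inner ℝ X (power d y.1) ∂(sphereMeasure n) :=
  (integral_inner (integrable_sphereMeasure hn
    (continuous_power.comp continuous_subtype_val)) X).symm

theorem sphereAverage_mem_convexHull (hn : 0 < n) :
    sphereAverage d n ∈ convexHull ℝ (unitPowers d n) := by
  have := isProbabilityMeasure_sphereMeasure hn
  have hcomp : IsCompact (unitPowers d n) := by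
    have : unitPowers d n = power d '' Metric.sphere 0 1 := by
      ext T
      simp only [unitPowers, Set.mem_ofPred_eq, Set.mem_image, mem_sphere_zero_iff_norm]
      exact exists_congr fun x => and_congr_right fun _ => eq_comm
    rw [this]
    exact (isCompact_sphere _ _).image continuous_power
  refine (convex_convexHull ℝ _).integral_mem
    (isCompact_convexHull_of_finiteDimensional hcomp).isClosed
    (Filter.Eventually.of_forall fun y => subset_convexHull _ _ ⟨y.1, ?_, rfl⟩)
    (integrable_sphereMeasure hn (continuous_power.comp continuous_subtype_val))
  exact mem_sphere_zero_iff_norm.1 y.2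

theorem sphereAverage_mem_symDensityTensors (hn : 0 < n) :
    sphereAverage d n ∈ symDensityTensors d n :=
  convexHull_unitPowers_subset (sphereAverage_mem_convexHull hn)

theorem inner_power_power (x y : EuclideanSpace ℝ (Fin n)) :
    inner ℝ (power d x) (power d y) = inner ℝ x y ^ (2 * d) := by
  rw [power, power, inner_outer_outer]
  simp [two_mul]

theorem inner_power_sphereAverage (hn : 0 < n) {x : EuclideanSpace ℝ (Fin n)} (hx : ‖x‖ = 1) :
    inner ℝ (power d x) (sphereAverage d n) = sphereMoment d n := by
  rw [inner_sphereAverage hn, ← integral_inner_pow_sphereMeasure hn d hx]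
  simp only [inner_power_power]

/-- Pairing with the sphere average is a multiple of the trace on symmetric tensors. -/
theorem inner_sphereAverage_of_mem_symTensors (hd : 0 < d) (hn : 0 < n)
    {R : Tensor ℝ (Modes d) n} (hR : R ∈ symTensors ℝ (Modes d) n) :
    inner ℝ (sphereAverage d n) R = sphereMoment d n * tensorTrace R := by
  let g : Tensor ℝ (Modes d) n →ₗ[ℝ] ℝ := sphereMoment d n • pairTrace 1
  -- Two linear functionals that agree on the unit powers agree on their span.
  have h : Set.EqOn (innerₛₗ ℝ (sphereAverage d n)) g
      (unitPowers d n) := by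
    rintro _ ⟨x, hx, rfl⟩
    rw [innerₛₗ_apply_apply, real_inner_comm, inner_power_sphereAverage hn hx,
      show g _ = sphereMoment d n * pairTrace 1 (power d x) from rfl, pairTrace_one, tensorTrace_power hx, mul_one]
  exact LinearMap.eqOn_span h (span_unitPowers hd ▸ hR)

theorem integral_inner_power (hd : 0 < d) (hn : 0 < n) {R : Tensor ℝ (Modes d) n}
    (hR : R ∈ symDensityTensors d n) :
    ∫ y, inner ℝ R (power d y.1) ∂(sphereMeasure n) = sphereMoment d n := by
  rw [← inner_sphereAverage hn, real_inner_comm, inner_sphereAverage_of_mem_symTensors hd hn hR.1,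
    tensorTrace_of_mem_symDensityTensors hR, mul_one]

theorem inner_power_le_specNorm (R : Tensor ℝ (Modes d) n) {x : EuclideanSpace ℝ (Fin n)}
    (hx : ‖x‖ = 1) : inner ℝ R (power d x) ≤ specNorm R := by
  rw [← real_inner_comm]
  exact (Real.le_norm_self _).trans
    (le_specNorm R (unitPowers_subset_productStates (d := d) ⟨x, hx, rfl⟩))

theorem continuous_inner_power (R : Tensor ℝ (Modes d) n) :
    Continuous fun y : Metric.sphere (0 : EuclideanSpace ℝ (Fin n)) 1 =>
      inner ℝ R (power d y.1) :=
  Continuous.inner (𝕜 := ℝ) continuous_const (continuous_power.comp continuous_subtype_val)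

theorem integral_specNorm_sub (hd : 0 < d) (hn : 0 < n) {R : Tensor ℝ (Modes d) n}
    (hR : R ∈ symDensityTensors d n) :
    ∫ y, (specNorm R - inner ℝ R (power d y.1)) ∂(sphereMeasure n) =
      specNorm R - sphereMoment d n := by
  have := isProbabilityMeasure_sphereMeasure hn
  rw [integral_sub (integrable_const _) (integrable_sphereMeasure hn (continuous_inner_power R)),
    integral_inner_power hd hn hR]
  simp

theorem sphereMoment_le_specNorm (hd : 0 < d) (hn : 0 < n) {R : Tensor ℝ (Modes d) n}
    (hR : R ∈ symDensityTensors d n) : sphereMoment d n ≤ specNorm R := by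
  rw [← sub_nonneg, ← integral_specNorm_sub hd hn hR]
  exact integral_nonneg fun y =>
    sub_nonneg.2 (inner_power_le_specNorm R (mem_sphere_zero_iff_norm.1 y.2))

/-- The arithmetic-geometric mean inequality replaces the product of 2d linear forms by the mean of
their 2d-th powers, all with the same moment. -/
theorem specNorm_sphereAverage_le (hd : 0 < d) (hn : 0 < n) :
    specNorm (sphereAverage d n) ≤ sphereMoment d n := by
  have : Nonempty (Modes d) := ⟨Sum.inl ⟨0, hd⟩⟩
  refine specNorm_le hn ?_
  rintro _ ⟨y, hy, rfl⟩
  rw [inner_sphereAverage hn]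
  have hcard : Fintype.card (Modes d) = 2 * d := by simp [two_mul]
  have hint : ∀ k, Integrable (fun z : Metric.sphere (0 : EuclideanSpace ℝ (Fin n)) 1 =>
      ((2 * d : ℕ) : ℝ)⁻¹ * inner ℝ (y k) z.1 ^ (2 * d)) (sphereMeasure n) := fun k =>
    integrable_sphereMeasure hn (by fun_prop)
  calc ‖∫ z, inner ℝ (outer y) (power d z.1) ∂(sphereMeasure n)‖
      ≤ ∫ z, ∑ k, ((2 * d : ℕ) : ℝ)⁻¹ * inner ℝ (y k) z.1 ^ (2 * d) ∂(sphereMeasure n) := by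
        refine norm_integral_le_of_norm_le (integrable_finsetSum _ fun k _ => hint k)
          (Filter.Eventually.of_forall fun z => ?_)
        rw [power, inner_outer_outer, norm_prod]
        refine (Finset.prod_le_sum_pow_card_div _ fun k => norm_nonneg _).trans_eq ?_
        rw [hcard]
        refine Finset.sum_congr rfl fun k _ => ?_
        rw [Real.norm_eq_abs, (even_two_mul d).pow_abs]
    _ = sphereMoment d n := by
        rw [integral_finsetSum _ fun k _ => hint k]
        simp only [integral_const_mul, integral_inner_pow_sphereMeasure hn d (hy _)]
        rw [Finset.sum_const, Finset.card_univ, hcard, nsmul_eq_mul, ← mul_assoc,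
          mul_inv_cancel₀ (by positivity), one_mul]

theorem sphereMoment_eq_specNorm_iff (hd : 0 < d) (hn : 0 < n) {R : Tensor ℝ (Modes d) n}
    (hR : R ∈ symDensityTensors d n) :
    sphereMoment d n = specNorm R ↔ R = sphereAverage d n := by
  have : Nonempty (Modes d) := ⟨Sum.inl ⟨0, hd⟩⟩
  constructor
  · intro h
    have hpos : (sphereMeasure n).IsOpenPosMeasure := isOpenPosMeasure_sphereMeasure
    have h0 := integral_specNorm_sub hd hn hR
    have hcont : Continuous fun y : Metric.sphere (0 : EuclideanSpace ℝ (Fin n)) 1 =>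
        specNorm R - inner ℝ R (power d y.1) :=
      continuous_const.sub (continuous_inner_power R)
    -- A continuous nonnegative function of integral zero vanishes everywhere, as the measure
    -- charges every nonempty open set.
    rw [← h, sub_self, h, integral_eq_zero_iff_of_nonneg (fun y =>
      sub_nonneg.2 (inner_power_le_specNorm R (mem_sphere_zero_iff_norm.1 y.2)))
      (integrable_sphereMeasure hn hcont), hcont.ae_eq_iff_eq _ continuous_zero] at h0
    rw [← sub_eq_zero]
    refine eq_zero_of_inner_power_eq_zero
      (Submodule.sub_mem _ hR.1 (sphereAverage_mem_symDensityTensors hn).1) fun x hx => ?_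
    have h1 := congrFun h0 ⟨x, mem_sphere_zero_iff_norm.2 hx⟩
    have h2 := inner_power_sphereAverage (d := d) hn hx
    simp only [Pi.zero_apply] at h1
    rw [real_inner_comm] at h1
    change inner ℝ (power d x) _ = 0
    rw [inner_sub_right, h2]
    linarith
  · rintro rfl
    exact le_antisymm (sphereMoment_le_specNorm hd hn hR) (specNorm_sphereAverage_le hd hn)

end SymDensity

open SymDensity

theorem theorem4p12 (d n : ℕ) (hd : 2 ≤ d) (hn : 2 ≤ n) :
    -- bounds for the two norms of a symmetric density tensor, and their equality cases
    (∀ R ∈ SymDensity.symDensityTensors d n,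
      (∏ k ∈ Finset.range d, ((1 : ℝ) / 2 + k)) / (∏ k ∈ Finset.range d, ((n : ℝ) / 2 + k))
          ≤ SymDensity.specNorm R ∧
      SymDensity.specNorm R ≤ 1 ∧
      1 ≤ SymDensity.nucNorm R ∧
      SymDensity.nucNorm R ≤ SymDensity.betaSym ℝ (SymDensity.Modes d) n ∧
      (SymDensity.specNorm R = 1 ↔
        ∃ x : EuclideanSpace ℝ (Fin n), ‖x‖ = 1 ∧ R = SymDensity.power d x) ∧
      ((∏ k ∈ Finset.range d, ((1 : ℝ) / 2 + k)) / (∏ k ∈ Finset.range d, ((n : ℝ) / 2 + k))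
          = SymDensity.specNorm R ↔ R = SymDensity.sphereAverage d n) ∧
      (SymDensity.nucNorm R = 1 ↔
        SymDensity.complexify R ∈ SymDensity.separable d n) ∧
      (SymDensity.complexify R ∈ SymDensity.separable d n ↔
        R ∈ SymDensity.stronglySeparable d n)) ∧
    -- the minimizer is itself a symmetric density tensor
    SymDensity.sphereAverage d n ∈ SymDensity.symDensityTensors d n ∧
    -- the real strongly separable tensors form a proper face of maximal dimension
    SymDensity.IsFace (SymDensity.nucBall d n) (SymDensity.stronglySeparable d n) ∧
    SymDensity.stronglySeparable d n ≠ SymDensity.nucBall d n ∧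
    SymDensity.affDim (SymDensity.stronglySeparable d n)
      = (n + 2 * d - 1).choose (2 * d) - 1 ∧
    (∀ F : Set (SymDensity.Tensor ℝ (SymDensity.Modes d) n),
      SymDensity.IsFace (SymDensity.nucBall d n) F → F ≠ SymDensity.nucBall d n →
      SymDensity.affDim F ≤ SymDensity.affDim (SymDensity.stronglySeparable d n)) ∧
    -- its supporting hyperplane
    (∀ B ∈ SymDensity.nucBall d n, SymDensity.tensorTrace B ≤ 1 ∧
      (SymDensity.tensorTrace B = 1 ↔ B ∈ SymDensity.stronglySeparable d n)) ∧
    -- the number of terms in a convex combination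
    (∀ R ∈ SymDensity.stronglySeparable d n,
      ∃ r : ℕ, r ≤ (n + 2 * d - 1).choose (2 * d) ∧
      ∃ (a : Fin r → ℝ) (x : Fin r → EuclideanSpace ℝ (Fin n)),
        (∀ k, 0 ≤ a k) ∧ ∑ k, a k = 1 ∧ (∀ k, ‖x k‖ = 1) ∧
        R = ∑ k, a k • SymDensity.power d (x k)) := by
  have hd0 : 0 < d := by omega
  have hn0 : 0 < n := by omega
  have : Nonempty (Modes d) := ⟨Sum.inl ⟨0, hd0⟩⟩
  refine ⟨fun R hR => ?_, sphereAverage_mem_symDensityTensors hn0, isFace_stronglySeparable hd hn0,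
    stronglySeparable_ne_nucBall hd0, affDim_stronglySeparable hd0 hn0,
    fun F hF hne => affDim_le_of_isFace hd0 hn0 hF hne,
    fun B hB => ⟨(tensorTrace_le_nucNorm hd0 B).trans hB.2, tensorTrace_eq_one_iff hd hn0 hB⟩,
    fun R hR => exists_sum_power_of_mem_stronglySeparable hd0 hn0 hR⟩
  have htr := tensorTrace_of_mem_symDensityTensors hR
  have hnorm := norm_le_one_of_mem_symDensityTensors hR
  have hnuc : 1 ≤ nucNorm R := htr ▸ tensorTrace_le_nucNorm hd0 R
  have hsep : complexify R ∈ separable d n ↔ R ∈ stronglySeparable d n :=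
    ⟨mem_stronglySeparable_of_complexify_mem_separable hd hR, complexify_mem_separable⟩
  refine ⟨sphereMoment_le_specNorm hd0 hn0 hR, (specNorm_le_norm hn0 R).trans hnorm, hnuc,
    nucNorm_le_betaSym hR.1 (ne_zero_of_mem_symDensityTensors hR) hnorm,
    specNorm_eq_one_iff hd hn0 hR, sphereMoment_eq_specNorm_iff hd0 hn0 hR, ?_, hsep⟩
  rw [hsep]
  exact ⟨fun h => (tensorTrace_eq_one_iff hd hn0 ⟨hR.1, h.le⟩).1 htr,
    fun h => le_antisymm (mem_nucBall_of_mem_stronglySeparable hd0 hn0 h).2 hnuc⟩
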